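/- Let $U\subseteq\mathbb{R}^n\times\mathbb{R}^2$ be an open set of points $(z,x,t)$ and let $M_{\mu\nu},K_{\mu\nu},D_\mu$ ($1\le\mu,\nu\le n$) be smooth ($C^\infty$) real functions on $U$. Consider the first-order system (summation over repeated indices) $$E_\mu(z):=M_{\mu\nu}(z,x,t)\,z^\nu_t+K_{\mu\nu}(z,x,t)\,z^\nu_x+D_\mu(z,x,t)=0,\qquad \mu=1,\dots,n .$$ A *field* in $U$ is a smooth map $z:\Omega\to\mathbb{R}^n$ on an open set $\Omega\subseteq\mathbb{R}^2$ with $(z(x,t),x,t)\in U$ for all $(x,t)\in\Omega$. The *variational form* of the system along $z$ is $L_z\eta=\frac{d}{ds}\big|_{s=0}E(z+s\eta)$. The system is *self-adjoint in $U$* if $L_z$ is formally self-adjoint for every field $z$ in $U$, that is, $\iint\xi^\mu (L_z\eta)_\mu\,dx\,dt=\iint\eta^\mu (L_z\xi)_\mu\,dx\,dt$ for all smooth $\xi,\eta$ with compact support in $\Omega$. For smooth functions $F_\mu,G_\mu,B$ on $U$, the system is *the Birkhoff system of $(F,G,B)$ on $U$* if, on $U$, $$M_{\mu\nu}=\frac{\partial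 F_\nu}{\partial z^\mu}-\frac{\partial F_\mu}{\partial z^\nu},\qquad K_{\mu\nu}=\frac{\partial G_\nu}{\partial z^\mu}-\frac{\partial G_\mu}{\partial z^\nu},\qquad D_\mu=-\Big(\frac{\partial B}{\partial z^\mu}+\frac{\partial F_\mu}{\partial t}+\frac{\partial G_\mu}{\partial x}\Big);$$ it is *of Birkhoffian type on $U$* if such smooth $F,G,B$ exist. It is *derived from the Pfaffian action of $(F,G,B)$ on $U$* if $E$ is the variational derivative of $$A(z)=\int_{t_1}^{t_2}\!\!\int_{x_1}^{x_2}\big(F_\nu z^\nu_t+G_\nu z^\nu_x-B\big)\,dx\,dt ,$$ that is, $\frac{d}{ds}\big|_{s=0}A(z+s\eta)=\int_{t_1}^{t_2}\!\int_{x_1}^{x_2}E_\mu(z)\,\eta^\mu\,dx\,dt$ for every rectangle $[x_1,x_2]\times[t_1,t_2]$ with $x_1<x_2$, $t_1<t_2$, every field $z$ in $U$ defined on an open neighbourhood of it, and every smooth $\eta:\mathbb{R}^2\to\mathbb{R}^n$ vanishing on its boundary. Then: 1. Suppose that each nonempty slice $\{z:(z,x,t)\in U\}$ is star-shaped about a point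 $c(x,t)$ depending smoothly on $(x,t)$ (for instance $U=\mathbb{R}^n\times\mathbb{R}^2$). Then the following are equivalent: the system is self-adjoint in $U$; it is of Birkhoffian type on $U$; it is derived on $U$ from the Pfaffian action of some smooth $(F,G,B)$. 2. For an arbitrary open $U$, the system is self-adjoint in $U$ if and only if every point of $U$ has an open neighbourhood $V\subseteq U$ on which the system is of Birkhoffian type. 3. For an arbitrary open $U$ and smooth $F,G,B$ on $U$, the system is the Birkhoff system of $(F,G,B)$ on $U$ if and only if it is derived on $U$ from the Pfaffian action of $(F,G,B)$. -/

import Mathlib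

open scoped ContDiff

noncomputable section

namespace Birkhoff

/-- The plane of independent variables, with points `(x, t)`. -/
abbrev Base : Type := ℝ × ℝ

/-- The space of points `(z, x, t)`, written `(z, (x, t))`, with `z ∈ ℝⁿ`. -/
abbrev Total (n : ℕ) : Type := (Fin n → ℝ) × Base

variable {n : ℕ}

/-- `∂f/∂z^μ` for a function `f(z, x, t)`. -/
def dz (μ : Fin n) (f : Total n → ℝ) (p : Total n) : ℝ :=
  fderiv ℝ f p (Pi.single μ 1, (0, 0))

/-- The explicit partial derivative `∂f/∂x` (with `z`, `t` fixed) of a function `f(z, x, t)`. -/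
def dx (f : Total n → ℝ) (p : Total n) : ℝ := fderiv ℝ f p (0, (1, 0))

/-- The explicit partial derivative `∂f/∂t` (with `z`, `x` fixed) of a function `f(z, x, t)`. -/
def dt (f : Total n → ℝ) (p : Total n) : ℝ := fderiv ℝ f p (0, (0, 1))

/-- The derivative `z_x` of a field `z(x, t)`. -/
def fieldX (z : Base → Fin n → ℝ) (q : Base) : Fin n → ℝ := fderiv ℝ z q (1, 0)

/-- The derivative `z_t` of a field `z(x, t)`. -/
def fieldT (z : Base → Fin n → ℝ) (q : Base) : Fin n → ℝ := fderiv ℝ z q (0, 1)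

/-- The left-hand side `M_{μν}(z,x,t) z^ν_t + K_{μν}(z,x,t) z^ν_x + D_μ(z,x,t)` of the first-order
system, evaluated on the field `z` at the point `q = (x, t)`. -/
def sysExpr (M K : Total n → Fin n → Fin n → ℝ) (D : Total n → Fin n → ℝ)
    (z : Base → Fin n → ℝ) (q : Base) (μ : Fin n) : ℝ :=
  ∑ ν, M (z q, q) μ ν * fieldT z q ν + ∑ ν, K (z q, q) μ ν * fieldX z q ν + D (z q, q) μ

/-- The variational form (linearization) of the system along the field `z`, applied to the
variation `η`: the derivative at `s = 0` of the left-hand side evaluated on `z + s η`. -/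
def variationalForm (M K : Total n → Fin n → Fin n → ℝ) (D : Total n → Fin n → ℝ)
    (z η : Base → Fin n → ℝ) (q : Base) (μ : Fin n) : ℝ :=
  deriv (fun s : ℝ => sysExpr M K D (z + s • η) q μ) 0

/-- `z` is a smooth field on the open set `Ω` of the `(x, t)`-plane with graph in `U`. -/
structure IsFieldOn (U : Set (Total n)) (Ω : Set Base) (z : Base → Fin n → ℝ) : Prop where
  isOpen : IsOpen Ω
  smooth : ContDiffOn ℝ ∞ z Ω
  graph : ∀ q ∈ Ω, (z q, q) ∈ U

/-- `η` is a smooth function with compact support contained in `Ω`. -/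
structure IsTestOn (Ω : Set Base) (η : Base → Fin n → ℝ) : Prop where
  smooth : ContDiff ℝ ∞ η
  compact : HasCompactSupport η
  support : tsupport η ⊆ Ω

/-- Variational self-adjointness in the region `U`: along every (local) field with graph in `U`,
the variational form of the system coincides with its formal adjoint with respect to the pairing
`(ξ, η) ↦ ∫∫ ξ^μ η^μ dx dt`. -/
def IsSelfAdjointOn (U : Set (Total n)) (M K : Total n → Fin n → Fin n → ℝ)
    (D : Total n → Fin n → ℝ) : Prop :=
  ∀ (Ω : Set Base) (z : Base → Fin n → ℝ), IsFieldOn U Ω z →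
    ∀ ξ η : Base → Fin n → ℝ, IsTestOn Ω ξ → IsTestOn Ω η →
      ∫ q, ∑ μ, ξ q μ * variationalForm M K D z η q μ =
        ∫ q, ∑ μ, η q μ * variationalForm M K D z ξ q μ

/-- The functions `F_μ`, `G_μ`, `B` are smooth on `U`. -/
structure IsSmoothData (U : Set (Total n)) (F G : Total n → Fin n → ℝ) (B : Total n → ℝ) :
    Prop where
  smoothF : ContDiffOn ℝ ∞ F U
  smoothG : ContDiffOn ℝ ∞ G U
  smoothB : ContDiffOn ℝ ∞ B U

/-- On `U`, the system is the Birkhoff system of `F`, `G` and the Birkhoffian `B`. -/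
structure IsBirkhoffRepr (U : Set (Total n)) (M K : Total n → Fin n → Fin n → ℝ)
    (D : Total n → Fin n → ℝ) (F G : Total n → Fin n → ℝ) (B : Total n → ℝ) : Prop where
  eqM : ∀ p ∈ U, ∀ μ ν, M p μ ν = dz μ (fun r => F r ν) p - dz ν (fun r => F r μ) p
  eqK : ∀ p ∈ U, ∀ μ ν, K p μ ν = dz μ (fun r => G r ν) p - dz ν (fun r => G r μ) p
  eqD : ∀ p ∈ U, ∀ μ, D p μ = -(dz μ B p + dt (fun r => F r μ) p + dx (fun r => G r μ) p)

/-- The system is of Birkhoffian type on `U`. -/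
def IsBirkhoffianOn (U : Set (Total n)) (M K : Total n → Fin n → Fin n → ℝ)
    (D : Total n → Fin n → ℝ) : Prop :=
  ∃ (F G : Total n → Fin n → ℝ) (B : Total n → ℝ),
    IsSmoothData U F G B ∧ IsBirkhoffRepr U M K D F G B

/-- The Lagrange density `F_ν z^ν_t + G_ν z^ν_x - B` along the field `z`. -/
def lagrangeDensity (F G : Total n → Fin n → ℝ) (B : Total n → ℝ) (z : Base → Fin n → ℝ)
    (q : Base) : ℝ :=
  ∑ ν, F (z q, q) ν * fieldT z q ν + ∑ ν, G (z q, q) ν * fieldX z q ν - B (z q, q)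

/-- The Pfaffian action of the field `z` over the rectangle `[x₁, x₂] × [t₁, t₂]`. -/
def pfaffianAction (F G : Total n → Fin n → ℝ) (B : Total n → ℝ) (x₁ x₂ t₁ t₂ : ℝ)
    (z : Base → Fin n → ℝ) : ℝ :=
  ∫ t in t₁..t₂, ∫ x in x₁..x₂, lagrangeDensity F G B z (x, t)

/-- On `U`, the system is derived from the Pfaffian action of `F`, `G`, `B`: the left-hand side of
the system is the variational derivative of the action. That is, over every rectangle and along
every field with graph in `U`, the first variation of the action in a direction `η` that vanishes
on the boundary of the rectangle exists and is the integral of the left-hand side against `η`. -/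
def IsDerivedFromAction (U : Set (Total n)) (M K : Total n → Fin n → Fin n → ℝ)
    (D : Total n → Fin n → ℝ) (F G : Total n → Fin n → ℝ) (B : Total n → ℝ) : Prop :=
  ∀ (x₁ x₂ t₁ t₂ : ℝ), x₁ < x₂ → t₁ < t₂ →
    ∀ (Ω : Set Base) (z : Base → Fin n → ℝ), IsFieldOn U Ω z →
      Set.Icc x₁ x₂ ×ˢ Set.Icc t₁ t₂ ⊆ Ω →
      ∀ η : Base → Fin n → ℝ, ContDiff ℝ ∞ η →
        (∀ q ∈ frontier (Set.Icc x₁ x₂ ×ˢ Set.Icc t₁ t₂), η q = 0) →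
        HasDerivAt (fun s : ℝ => pfaffianAction F G B x₁ x₂ t₁ t₂ (z + s • η))
          (∫ t in t₁..t₂, ∫ x in x₁..x₂, ∑ μ, sysExpr M K D z (x, t) μ * η (x, t) μ) 0

/-- On `U`, the system is derivable from some Pfaffian action with smooth coefficients. -/
def IsPfaffianDerivableOn (U : Set (Total n)) (M K : Total n → Fin n → Fin n → ℝ)
    (D : Total n → Fin n → ℝ) : Prop :=
  ∃ (F G : Total n → Fin n → ℝ) (B : Total n → ℝ),
    IsSmoothData U F G B ∧ IsDerivedFromAction U M K D F G B

/-- Each slice `{z | (z, x, t) ∈ U}` is star-shaped about a centre `c(x, t)` that depends smoothly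
on `(x, t)`. (For instance `U` is the whole space, or a product of a ball with an open set.) -/
def IsStarShapedInZ (U : Set (Total n)) : Prop :=
  ∃ c : Base → Fin n → ℝ, ContDiffOn ℝ ∞ c (Prod.snd '' U) ∧
    ∀ q ∈ Prod.snd '' U, StarConvex ℝ (c q) {z | (z, q) ∈ U}

end Birkhoff

end

/-! Everything passes through the pointwise conditions `IsClosedSystem`. For each fixed `(x, t)`
read `M` and `K` as two-forms and `D` as a one-form in `z`. The conditions say that `M` and `K` are
skew and closed, and that `M_t + K_x + dD = 0`, where `d` acts in `z` only.

Self-adjointness is equivalent to these conditions. By `lagrange_identity`, `ξ · Lη - η · Lξ` is a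
divergence minus `η · adjointDefect ξ`, and for test functions the divergence integrates to zero.
Hence closedness gives self-adjointness. Conversely, the fundamental lemma of the calculus of
variations makes the defect vanish pointwise. At a point the defect is linear in `ξ, ξ_x, ξ_t`, with
coefficients affine in `z_x, z_t`. All these values can be prescribed freely by affine fields and
cut-off affine maps, so every coefficient vanishes, and the coefficients are exactly the closedness
conditions.

A Birkhoff system has `M = dF`, `K = dG`, `D = -(dB + F_t + G_x)`, so it is closed because second
derivatives commute. When the slices are star-shaped, Poincaré's lemma with parameters reverses
this: it gives `F` and `G`, the third condition then says that `D + F_t + G_x` is a closed one-form,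
and a second use of the lemma gives `B`. The closedness conditions are local and balls have
star-shaped slices, which settles an arbitrary `U`.

For the action, `densityVariation_eq` writes the first variation of the density as the Birkhoff
expression paired with `η` plus the divergence of `(G · η, F · η)`, whose integral vanishes with `η`
on the boundary. So being derived from the action means agreeing with the Birkhoff system along
every field, and affine fields turn this into equality of coefficients. -/

open scoped ContDiff

noncomputable section

namespace Birkhoff

open MeasureTheory Set Filter Topology

/-! ### Smooth dependence of integrals on parameters -/

section ParametricIntegral

variable {E Y F : Type} [NormedAddCommGroup E] [NormedSpace ℝ E]
  [NormedAddCommGroup Y] [NormedSpace ℝ Y] [MeasurableSpace Y] [BorelSpace Y]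
  [NormedAddCommGroup F] [NormedSpace ℝ F]
  {U : Set E} {W : Set (E × Y)} {R : Set Y} {μ : Measure Y} [IsFiniteMeasureOnCompacts μ]

/-- Differentiation under the integral sign over a compact set, for an integrand which is
continuously differentiable near it. -/
theorem hasFDerivAt_integral_of_contDiffOn {h : E × Y → F} (hW : IsOpen W) (hR : IsCompact R)
    (hh : ContDiffOn ℝ 1 h W) {p : E} (hp : ∀ y ∈ R, (p, y) ∈ W) :
    HasFDerivAt (fun p => ∫ y in R, h (p, y) ∂μ)
      (∫ y in R, (fderiv ℝ h (p, y)).comp (ContinuousLinearMap.inl ℝ E Y) ∂μ) p := by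
  have hcont : ContinuousOn (fun w => ‖(fderiv ℝ h w).comp (ContinuousLinearMap.inl ℝ E Y)‖) W :=
    (((hh.continuousOn_fderiv_of_isOpen hW le_rfl)).clm_comp continuousOn_const).norm
  have hmk : Continuous fun y : Y => (p, y) := by fun_prop
  obtain ⟨C, hC⟩ := (hR.image_of_continuousOn
    (hcont.comp hmk.continuousOn (fun y hy => hp y hy))).isBounded.bddAbove
  have hopen : IsOpen (W ∩ (fun w => ‖(fderiv ℝ h w).comp (ContinuousLinearMap.inl ℝ E Y)‖) ⁻¹'
      Iio (C + 1)) := hcont.isOpen_inter_preimage hW isOpen_Iio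
  -- `C` bounds the partial derivative only over `{p} × R`. Compactness of `R` extends the bound `C
  -- + 1` to a tube around it, which supplies the dominating constant.
  obtain ⟨u, v, hu, -, hpu, hRv, huv⟩ := generalized_tube_lemma (isCompact_singleton (x := p)) hR
    hopen (by
      rintro ⟨p', y⟩ ⟨rfl, hy⟩
      refine ⟨hp y hy, ?_⟩
      have := hC ⟨y, hy, rfl⟩
      simp only [Function.comp_apply] at this
      simp only [mem_preimage, mem_Iio]
      linarith)
  have huW : ∀ x ∈ u, ∀ y ∈ R, (x, y) ∈ W := fun x hx y hy => (huv ⟨hx, hRv hy⟩).1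
  have hun : u ∈ 𝓝 p := hu.mem_nhds (hpu rfl)
  have hsec : ∀ x ∈ u, ContinuousOn (fun y => h (x, y)) R := fun x hx =>
    hh.continuousOn.comp (by fun_prop) (fun y hy => huW x hx y hy)
  refine hasFDerivAt_integral_of_dominated_of_fderiv_le (bound := fun _ => C + 1)
    (F' := fun x y => (fderiv ℝ h (x, y)).comp (ContinuousLinearMap.inl ℝ E Y)) hun ?_ ?_ ?_ ?_ ?_ ?_
  · filter_upwards [hun] with x hx
    exact (hsec x hx).aestronglyMeasurable_of_isCompact hR hR.measurableSet
  · exact (hsec p (hpu rfl)).integrableOn_compact hR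
  · refine ContinuousOn.aestronglyMeasurable_of_isCompact ?_ hR hR.measurableSet
    refine ContinuousOn.clm_comp ?_ continuousOn_const
    exact (hh.continuousOn_fderiv_of_isOpen hW le_rfl).comp hmk.continuousOn (fun y hy => hp y hy)
  · filter_upwards [ae_restrict_mem hR.measurableSet] with y hy x hx
    exact le_of_lt (huv (show (x, y) ∈ u ×ˢ v from ⟨hx, hRv hy⟩)).2
  · exact integrableOn_const hR.measure_ne_top
  · filter_upwards [ae_restrict_mem hR.measurableSet] with y hy x hx
    have h1 : HasFDerivAt h (fderiv ℝ h (x, y)) (x, y) :=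
      ((hh.differentiableOn one_ne_zero).differentiableAt
        (hW.mem_nhds (huW x hx y hy))).hasFDerivAt
    exact h1.comp x (hasFDerivAt_prodMk_left x y)

/-- The derivative of a parametric integral is again one, with integrand valued in continuous linear
maps. The induction on `k` therefore has to quantify over the target space `F`. -/
theorem contDiffOn_integral_nat (hU : IsOpen U) (hW : IsOpen W) (hR : IsCompact R)
    (hUR : U ×ˢ R ⊆ W) (k : ℕ) :
    ∀ {F : Type} [NormedAddCommGroup F] [NormedSpace ℝ F] {h : E × Y → F},
      ContDiffOn ℝ ∞ h W → ContDiffOn ℝ k (fun p => ∫ y in R, h (p, y) ∂μ) U := by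
  induction k with
  | zero =>
    intro F _ _ h hh
    refine contDiffOn_zero.2 fun p hp => ?_
    exact (hasFDerivAt_integral_of_contDiffOn hW hR (hh.of_le (by norm_cast))
      (fun y hy => hUR ⟨hp, hy⟩)).continuousAt.continuousWithinAt
  | succ k ih =>
    intro F _ _ h hh
    have hd : ∀ p ∈ U, HasFDerivAt (fun p => ∫ y in R, h (p, y) ∂μ)
        (∫ y in R, (fderiv ℝ h (p, y)).comp (ContinuousLinearMap.inl ℝ E Y) ∂μ) p := fun p hp =>
      hasFDerivAt_integral_of_contDiffOn hW hR (hh.of_le (by norm_cast))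
        (fun y hy => hUR ⟨hp, hy⟩)
    push_cast
    refine (contDiffOn_succ_iff_fderiv_of_isOpen hU).2
      ⟨fun p hp => (hd p hp).differentiableAt.differentiableWithinAt, by simp, ?_⟩
    refine ContDiffOn.congr (ih (h := fun w =>
      (fderiv ℝ h w).comp (ContinuousLinearMap.inl ℝ E Y)) ?_) (fun p hp => (hd p hp).fderiv)
    exact (hh.fderiv_of_isOpen hW (by simp)).clm_comp contDiffOn_const

theorem contDiffOn_integral {h : E × Y → F} (hU : IsOpen U) (hW : IsOpen W) (hR : IsCompact R)
    (hUR : U ×ˢ R ⊆ W) (hh : ContDiffOn ℝ ∞ h W) :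
    ContDiffOn ℝ ∞ (fun p => ∫ y in R, h (p, y) ∂μ) U :=
  contDiffOn_infty.2 fun k => contDiffOn_integral_nat hU hW hR hUR k hh

end ParametricIntegral

/-! ### Test functions, the fundamental lemma and the divergence theorem -/

section TestFunctions

variable {E : Type} [NormedAddCommGroup E] [NormedSpace ℝ E]

/-- Near a point outside `tsupport g` the product is identically zero, so the behaviour of `f` off
`Ω` does not matter. This handles fields, which are smooth only on `Ω`. -/
theorem contDiff_mul_of_tsupport_subset {Ω : Set E} (hΩ : IsOpen Ω) {g f : E → ℝ}
    (hg : ContDiff ℝ ∞ g) (hs : tsupport g ⊆ Ω) (hf : ContDiffOn ℝ ∞ f Ω) :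
    ContDiff ℝ ∞ (fun x => g x * f x) := by
  refine contDiff_iff_contDiffAt.2 fun x => ?_
  by_cases hx : x ∈ tsupport g
  · exact hg.contDiffAt.mul (hf.contDiffAt (hΩ.mem_nhds (hs hx)))
  · refine (contDiffAt_const (c := (0 : ℝ))).congr_of_eventuallyEq ?_
    filter_upwards [notMem_tsupport_iff_eventuallyEq.1 hx] with y hy
    simp [hy]

variable [FiniteDimensional ℝ E] [MeasurableSpace E] [BorelSpace E] {μ : Measure E}
  [μ.IsAddHaarMeasure]

/-- Integration by parts against the constant function `1`. -/
theorem integral_fderiv_eq_zero {f : E → ℝ} (hf : ContDiff ℝ ∞ f) (hc : HasCompactSupport f)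
    (v : E) : ∫ x, fderiv ℝ f x v ∂μ = 0 := by
  have hi : Integrable (fun x => fderiv ℝ f x v) μ := by
    refine Continuous.integrable_of_hasCompactSupport ?_ ?_
    · exact (hf.continuous_fderiv (by simp)).clm_apply continuous_const
    · exact hc.fderiv_apply ℝ v
  have := integral_mul_fderiv_eq_neg_fderiv_mul_of_integrable (μ := μ) (f := fun _ : E => (1 : ℝ))
    (g := f) (v := v) (by simp) (by simpa using hi)
    (by simpa using hf.continuous.integrable_of_hasCompactSupport hc)
    (fun x _ => differentiableAt_const _)
    (fun x _ => hf.differentiable (by simp) x)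
  simpa using this

/-- The fundamental lemma of the calculus of variations: testing gives vanishing almost everywhere
on `Ω`, and continuity improves this to every point. -/
theorem eqOn_zero_of_integral_mul_eq_zero {Ω : Set E} (hΩ : IsOpen Ω) {f : E → ℝ}
    (hf : ContinuousOn f Ω)
    (h : ∀ g : E → ℝ, ContDiff ℝ ∞ g → HasCompactSupport g → tsupport g ⊆ Ω →
      ∫ x, g x * f x ∂μ = 0) : ∀ x ∈ Ω, f x = 0 := by
  have h1 := hΩ.ae_eq_zero_of_integral_contDiff_smul_eq_zero (μ := μ)
    (hf.locallyIntegrableOn hΩ.measurableSet) h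
  have h2 : f =ᵐ[μ.restrict Ω] fun _ => 0 := (ae_restrict_iff' hΩ.measurableSet).2 h1
  exact Measure.eqOn_open_of_ae_eq h2 hΩ hf continuousOn_const

end TestFunctions

theorem tsupport_apply_subset {n : ℕ} (η : Base → Fin n → ℝ) (μ : Fin n) :
    tsupport (fun q => η q μ) ⊆ tsupport η :=
  closure_mono fun q hq h0 => hq (by simp [h0])

theorem integrable_mul_of_isTestOn_apply {n : ℕ} {Ω : Set Base} (hΩ : IsOpen Ω)
    {η : Base → Fin n → ℝ} (hη : IsTestOn Ω η) (μ : Fin n) {f : Base → ℝ}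
    (hf : ContDiffOn ℝ ∞ f Ω) : Integrable (fun q => η q μ * f q) := by
  have hsub : tsupport (fun q => η q μ) ⊆ tsupport η := tsupport_apply_subset η μ
  have hsm : ContDiff ℝ ∞ (fun q => η q μ) := contDiff_pi.1 hη.smooth μ
  have hc : HasCompactSupport (fun q => η q μ) :=
    hη.compact.of_isClosed_subset (isClosed_tsupport _) hsub
  exact (contDiff_mul_of_tsupport_subset hΩ hsm (hsub.trans hη.support) hf).continuous
    |>.integrable_of_hasCompactSupport hc.mul_right

/-- Every smooth map agrees near a given point of an open set with a test function on it. -/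
theorem exists_isTestOn_eventuallyEq {n : ℕ} {Ω : Set Base} (hΩ : IsOpen Ω) {q : Base}
    (hq : q ∈ Ω) {l : Base → Fin n → ℝ} (hl : ContDiff ℝ ∞ l) :
    ∃ ξ, IsTestOn Ω ξ ∧ ξ =ᶠ[𝓝 q] l := by
  obtain ⟨r, hr, hrΩ⟩ := Metric.nhds_basis_closedBall.mem_iff.1 (hΩ.mem_nhds hq)
  let χ : ContDiffBump q := ⟨r / 2, r, by positivity, by linarith⟩
  have hsub : tsupport (fun q => χ q • l q) ⊆ tsupport χ :=
    closure_mono (Function.support_smul_subset_left χ l)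
  refine ⟨fun q => χ q • l q, ⟨χ.contDiff.smul hl, ?_, ?_⟩, ?_⟩
  · exact χ.hasCompactSupport.of_isClosed_subset (isClosed_tsupport _) hsub
  · exact hsub.trans (χ.tsupport_eq.trans_subset hrΩ)
  · filter_upwards [χ.eventuallyEq_one] with x hx
    simp [hx]

/-- An iterated integral over a rectangle is the integral over the rectangle. -/
theorem integral_integral_eq_setIntegral_Icc {f : Base → ℝ} {x₁ x₂ t₁ t₂ : ℝ} (hx : x₁ ≤ x₂)
    (ht : t₁ ≤ t₂) (hf : ContinuousOn f (Icc x₁ x₂ ×ˢ Icc t₁ t₂)) :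
    ∫ t in t₁..t₂, ∫ x in x₁..x₂, f (x, t) = ∫ q in Icc x₁ x₂ ×ˢ Icc t₁ t₂, f q := by
  have hi : IntegrableOn f (Icc x₁ x₂ ×ˢ Icc t₁ t₂) :=
    hf.integrableOn_compact (isCompact_Icc.prod isCompact_Icc)
  rw [IntegrableOn, Measure.volume_eq_prod, ← Measure.prod_restrict] at hi
  rw [Measure.volume_eq_prod, ← Measure.prod_restrict, integral_prod_symm _ hi,
    intervalIntegral.integral_of_le ht, ← integral_Icc_eq_integral_Ioc]
  refine integral_congr_ae (Eventually.of_forall fun t => ?_)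
  simp only
  rw [intervalIntegral.integral_of_le hx, ← integral_Icc_eq_integral_Ioc]

/-- The divergence of a vector field that vanishes on the boundary of a rectangle has
integral zero. -/
theorem integral_divergence_eq_zero {f g : Base → ℝ} {x₁ x₂ t₁ t₂ : ℝ} (hx : x₁ ≤ x₂)
    (ht : t₁ ≤ t₂) {Ω : Set Base} (hΩ : IsOpen Ω) (hR : Icc x₁ x₂ ×ˢ Icc t₁ t₂ ⊆ Ω)
    (hf : ContDiffOn ℝ ∞ f Ω) (hg : ContDiffOn ℝ ∞ g Ω)
    (hf0 : ∀ q ∈ frontier (Icc x₁ x₂ ×ˢ Icc t₁ t₂), f q = 0)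
    (hg0 : ∀ q ∈ frontier (Icc x₁ x₂ ×ˢ Icc t₁ t₂), g q = 0) :
    ∫ q in Icc x₁ x₂ ×ˢ Icc t₁ t₂, (fderiv ℝ f q (1, 0) + fderiv ℝ g q (0, 1)) = 0 := by
  have hII : Icc x₁ x₂ ×ˢ Icc t₁ t₂ = Icc (x₁, t₁) (x₂, t₂) := Icc_prod_Icc _ _ _ _
  have hfr : frontier (Icc x₁ x₂ ×ˢ Icc t₁ t₂) =
      Icc x₁ x₂ ×ˢ {t₁, t₂} ∪ {x₁, x₂} ×ˢ Icc t₁ t₂ := by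
    rw [frontier_prod_eq, frontier_Icc hx, frontier_Icc ht, isClosed_Icc.closure_eq,
      isClosed_Icc.closure_eq]
  rw [hfr] at hf0 hg0
  have hdiff : ∀ {k : Base → ℝ}, ContDiffOn ℝ ∞ k Ω → ∀ q ∈ Ω, HasFDerivAt k (fderiv ℝ k q) q :=
    fun hk q hq => ((hk.differentiableOn (by simp)).differentiableAt (hΩ.mem_nhds hq)).hasFDerivAt
  have hcd : ∀ {k : Base → ℝ} (v : Base), ContDiffOn ℝ ∞ k Ω →
      ContinuousOn (fun q => fderiv ℝ k q v) Ω := fun v hk =>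
    (hk.continuousOn_fderiv_of_isOpen hΩ (by simp)).clm_apply continuousOn_const
  have hin : Ioo x₁ x₂ ×ˢ Ioo t₁ t₂ ⊆ Ω :=
    (Set.prod_mono Ioo_subset_Icc_self Ioo_subset_Icc_self).trans hR
  rw [hII] at hR ⊢
  rw [integral_divergence_prod_Icc_of_hasFDerivAt_of_le f g (fderiv ℝ f) (fderiv ℝ g)
    (x₁, t₁) (x₂, t₂) ⟨hx, ht⟩ (hf.continuousOn.mono hR) (hg.continuousOn.mono hR)
    (fun q hq => hdiff hf q (hin hq)) (fun q hq => hdiff hg q (hin hq))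
    ((((hcd _ hf).add (hcd _ hg)).mono hR).integrableOn_compact isCompact_Icc)]
  have e1 : ∫ x in x₁..x₂, g (x, t₂) = 0 := by
    refine (intervalIntegral.integral_congr (g := fun _ => 0) fun x hxx => ?_).trans (by simp)
    rw [uIcc_of_le hx] at hxx
    exact hg0 _ (Or.inl ⟨hxx, by simp⟩)
  have e2 : ∫ x in x₁..x₂, g (x, t₁) = 0 := by
    refine (intervalIntegral.integral_congr (g := fun _ => 0) fun x hxx => ?_).trans (by simp)
    rw [uIcc_of_le hx] at hxx
    exact hg0 _ (Or.inl ⟨hxx, by simp⟩)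
  have e3 : ∫ y in t₁..t₂, f (x₂, y) = 0 := by
    refine (intervalIntegral.integral_congr (g := fun _ => 0) fun y hy => ?_).trans (by simp)
    rw [uIcc_of_le ht] at hy
    exact hf0 _ (Or.inr ⟨by simp, hy⟩)
  have e4 : ∫ y in t₁..t₂, f (x₁, y) = 0 := by
    refine (intervalIntegral.integral_congr (g := fun _ => 0) fun y hy => ?_).trans (by simp)
    rw [uIcc_of_le ht] at hy
    exact hf0 _ (Or.inr ⟨by simp, hy⟩)
  simp [e1, e2, e3, e4]

/-! ### Calculus along fields and the first variation of the Lagrange density -/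

section Density

variable {n : ℕ} {U : Set (Total n)} {Ω : Set Base} {z η : Base → Fin n → ℝ}
  {F G : Total n → Fin n → ℝ} {B f : Total n → ℝ}

theorem fderiv_total_apply (f : Total n → ℝ) (p : Total n) (v : Fin n → ℝ) (a b : ℝ) :
    fderiv ℝ f p (v, (a, b)) = ∑ l, v l * dz l f p + a * dx f p + b * dt f p := by
  have hv : ((v, (a, b)) : Total n) = ∑ l, v l • ((Pi.single l 1, (0, 0)) : Total n)
      + a • ((0, (1, 0)) : Total n) + b • ((0, (0, 1)) : Total n) := by
    refine Prod.ext ?_ ?_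
    · simp only [Prod.fst_add, Prod.fst_sum, Prod.smul_fst, smul_zero, add_zero]
      conv_lhs => rw [pi_eq_sum_univ' v]
    · simp [Prod.snd_sum]
  rw [hv]
  simp only [map_add, map_sum, map_smul, smul_eq_mul]
  rfl

theorem contDiffOn_fderiv_apply (hU : IsOpen U) (hf : ContDiffOn ℝ ∞ f U) (v : Total n) :
    ContDiffOn ℝ ∞ (fun p => fderiv ℝ f p v) U :=
  (hf.fderiv_of_isOpen hU (by simp)).clm_apply contDiffOn_const

theorem contDiffOn_dz (hU : IsOpen U) (hf : ContDiffOn ℝ ∞ f U) (μ : Fin n) :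
    ContDiffOn ℝ ∞ (dz μ f) U := contDiffOn_fderiv_apply hU hf _

theorem contDiffOn_dx (hU : IsOpen U) (hf : ContDiffOn ℝ ∞ f U) :
    ContDiffOn ℝ ∞ (dx f) U := contDiffOn_fderiv_apply hU hf _

theorem contDiffOn_dt (hU : IsOpen U) (hf : ContDiffOn ℝ ∞ f U) :
    ContDiffOn ℝ ∞ (dt f) U := contDiffOn_fderiv_apply hU hf _

theorem _root_.ContDiffOn.hasFDerivAt_fderiv_of_isOpen {E F : Type*} [NormedAddCommGroup E]
    [NormedSpace ℝ E] [NormedAddCommGroup F] [NormedSpace ℝ F] {f : E → F} {U : Set E}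
    (hf : ContDiffOn ℝ ∞ f U) (hU : IsOpen U) {p : E} (hp : p ∈ U) :
    HasFDerivAt f (fderiv ℝ f p) p :=
  ((hf.differentiableOn (by simp)).differentiableAt (hU.mem_nhds hp)).hasFDerivAt

theorem IsFieldOn.hasFDerivAt (hz : IsFieldOn U Ω z) {q : Base} (hq : q ∈ Ω) :
    HasFDerivAt z (fderiv ℝ z q) q := hz.smooth.hasFDerivAt_fderiv_of_isOpen hz.isOpen hq

theorem IsFieldOn.contDiffOn_comp (hz : IsFieldOn U Ω z) (hf : ContDiffOn ℝ ∞ f U) :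
    ContDiffOn ℝ ∞ (fun q => f (z q, q)) Ω :=
  hf.comp (hz.smooth.prodMk contDiffOn_id) (fun q hq => hz.graph q hq)

theorem IsFieldOn.contDiffOn_fieldX (hz : IsFieldOn U Ω z) (ν : Fin n) :
    ContDiffOn ℝ ∞ (fun q => fieldX z q ν) Ω :=
  contDiffOn_pi.1 ((hz.smooth.fderiv_of_isOpen hz.isOpen (by simp)).clm_apply contDiffOn_const) ν

theorem IsFieldOn.contDiffOn_fieldT (hz : IsFieldOn U Ω z) (ν : Fin n) :
    ContDiffOn ℝ ∞ (fun q => fieldT z q ν) Ω :=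
  contDiffOn_pi.1 ((hz.smooth.fderiv_of_isOpen hz.isOpen (by simp)).clm_apply contDiffOn_const) ν

/-- Treating a variation `η` as a field in the whole space lets the regularity results for fields
serve for `η` too. -/
theorem _root_.ContDiff.isFieldOn_univ (hη : ContDiff ℝ ∞ η) : IsFieldOn univ univ η :=
  ⟨isOpen_univ, hη.contDiffOn, fun _ _ => mem_univ _⟩

theorem contDiff_fieldX (hη : ContDiff ℝ ∞ η) (ν : Fin n) :
    ContDiff ℝ ∞ (fun q => fieldX η q ν) :=
  contDiffOn_univ.1 (hη.isFieldOn_univ.contDiffOn_fieldX ν)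

theorem contDiff_fieldT (hη : ContDiff ℝ ∞ η) (ν : Fin n) :
    ContDiff ℝ ∞ (fun q => fieldT η q ν) :=
  contDiffOn_univ.1 (hη.isFieldOn_univ.contDiffOn_fieldT ν)

/-- Total derivatives of a function along a field. -/
theorem IsFieldOn.hasFDerivAt_comp (hU : IsOpen U) (hz : IsFieldOn U Ω z)
    (hf : ContDiffOn ℝ ∞ f U) {q : Base} (hq : q ∈ Ω) :
    HasFDerivAt (fun q => f (z q, q)) ((fderiv ℝ f (z q, q)).comp
      ((fderiv ℝ z q).prod (ContinuousLinearMap.id ℝ Base))) q :=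
  HasFDerivAt.comp (f := fun q => (z q, q)) q
    (hf.hasFDerivAt_fderiv_of_isOpen hU (hz.graph q hq))
    ((hz.hasFDerivAt hq).prodMk (hasFDerivAt_id q))

theorem IsFieldOn.fderiv_comp_t (hU : IsOpen U) (hz : IsFieldOn U Ω z)
    (hf : ContDiffOn ℝ ∞ f U) {q : Base} (hq : q ∈ Ω) :
    fderiv ℝ (fun q => f (z q, q)) q (0, 1) =
      ∑ l, fieldT z q l * dz l f (z q, q) + dt f (z q, q) := by
  rw [(hz.hasFDerivAt_comp hU hf hq).fderiv]
  simp [fderiv_total_apply, fieldT]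

theorem IsFieldOn.fderiv_comp_x (hU : IsOpen U) (hz : IsFieldOn U Ω z)
    (hf : ContDiffOn ℝ ∞ f U) {q : Base} (hq : q ∈ Ω) :
    fderiv ℝ (fun q => f (z q, q)) q (1, 0) =
      ∑ l, fieldX z q l * dz l f (z q, q) + dx f (z q, q) := by
  rw [(hz.hasFDerivAt_comp hU hf hq).fderiv]
  simp [fderiv_total_apply, fieldX]

theorem fderiv_coord {q : Base} (hη : DifferentiableAt ℝ η q) (ν : Fin n) (v : Base) :
    fderiv ℝ (fun q => η q ν) q v = fderiv ℝ η q v ν := by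
  rw [((hasFDerivAt_pi'.1 hη.hasFDerivAt) ν).fderiv]
  simp

theorem fieldT_add_smul {q : Base} (hz : DifferentiableAt ℝ z q) (hη : DifferentiableAt ℝ η q)
    (s : ℝ) : fieldT (z + s • η) q = fieldT z q + s • fieldT η q := by
  simp [fieldT, fderiv_add hz (hη.const_smul s), fderiv_const_smul hη]

theorem fieldX_add_smul {q : Base} (hz : DifferentiableAt ℝ z q) (hη : DifferentiableAt ℝ η q)
    (s : ℝ) : fieldX (z + s • η) q = fieldX z q + s • fieldX η q := by
  simp [fieldX, fderiv_add hz (hη.const_smul s), fderiv_const_smul hη]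

/-- The first variation of the Lagrange density along `z` in the direction `η`. -/
def densityVariation (F G : Total n → Fin n → ℝ) (B : Total n → ℝ) (z η : Base → Fin n → ℝ)
    (q : Base) : ℝ :=
  ∑ ν, F (z q, q) ν * fieldT η q ν + ∑ ν, G (z q, q) ν * fieldX η q ν +
    ∑ l, (∑ ν, dz l (fun r => F r ν) (z q, q) * fieldT z q ν +
      ∑ ν, dz l (fun r => G r ν) (z q, q) * fieldX z q ν - dz l B (z q, q)) * η q l

theorem hasDerivAt_comp_add_smul (hU : IsOpen U) (hf : ContDiffOn ℝ ∞ f U) {q : Base}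
    (hq : (z q, q) ∈ U) :
    HasDerivAt (fun s : ℝ => f ((z + s • η) q, q)) (∑ l, η q l * dz l f (z q, q)) 0 := by
  have h1 : HasDerivAt (fun s : ℝ => (((z + s • η) q, q) : Total n)) (η q, (0, 0)) 0 := by
    refine HasDerivAt.prodMk ?_ (hasDerivAt_const _ _)
    simpa using ((hasDerivAt_id (0 : ℝ)).smul_const (η q)).const_add (z q)
  have h2 := (hf.hasFDerivAt_fderiv_of_isOpen hU hq)
  have h3 : HasFDerivAt f (fderiv ℝ f (z q, q)) ((z + (0 : ℝ) • η) q, q) := by simpa using h2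
  have := h3.comp_hasDerivAt (0 : ℝ) h1
  rw [fderiv_total_apply, zero_mul, zero_mul, add_zero, add_zero] at this
  exact this

theorem hasDerivAt_lagrangeDensity (hU : IsOpen U) (hd : IsSmoothData U F G B)
    (hz : IsFieldOn U Ω z) (hη : ContDiff ℝ ∞ η) {q : Base} (hq : q ∈ Ω) :
    HasDerivAt (fun s : ℝ => lagrangeDensity F G B (z + s • η) q)
      (densityVariation F G B z η q) 0 := by
  have hzd := (hz.hasFDerivAt hq).differentiableAt
  have hηd : DifferentiableAt ℝ η q := hη.differentiable (by simp) q
  have hF := contDiffOn_pi.1 hd.smoothF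
  have hG := contDiffOn_pi.1 hd.smoothG
  have hg := hz.graph q hq
  have hT : ∀ ν, HasDerivAt (fun s : ℝ => fieldT (z + s • η) q ν) (fieldT η q ν) 0 := fun ν => by
    simp only [fieldT_add_smul hzd hηd]
    simpa using ((hasDerivAt_id (0 : ℝ)).mul_const (fieldT η q ν)).const_add (fieldT z q ν)
  have hX : ∀ ν, HasDerivAt (fun s : ℝ => fieldX (z + s • η) q ν) (fieldX η q ν) 0 := fun ν => by
    simp only [fieldX_add_smul hzd hηd]
    simpa using ((hasDerivAt_id (0 : ℝ)).mul_const (fieldX η q ν)).const_add (fieldX z q ν)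
  have key := ((HasDerivAt.fun_sum (u := Finset.univ) fun ν _ =>
      (hasDerivAt_comp_add_smul (η := η) hU (hF ν) hg).mul (hT ν)).add
    (HasDerivAt.fun_sum (u := Finset.univ) fun ν _ =>
      (hasDerivAt_comp_add_smul (η := η) hU (hG ν) hg).mul (hX ν))).sub
    (hasDerivAt_comp_add_smul (η := η) hU hd.smoothB hg)
  refine HasDerivAt.congr_deriv key ?_
  simp only [zero_smul, add_zero, densityVariation, Finset.sum_add_distrib, Finset.sum_mul,
    sub_mul, add_mul, Finset.sum_sub_distrib]
  -- The product rule leaves the sum over `ν` outside; `densityVariation` collects the coefficient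
  -- of each `η^l`.
  rw [Finset.sum_comm (f := fun ν l => η q l * dz l (fun p => F p ν) (z q, q) * fieldT z q ν),
    Finset.sum_comm (f := fun ν l => η q l * dz l (fun p => G p ν) (z q, q) * fieldX z q ν)]
  simp only [mul_comm, mul_left_comm]
  ring

/-- The Lagrange density is smooth along a field, jointly with the parameter of a variation. -/
theorem contDiffOn_lagrangeDensity_add_smul (hd : IsSmoothData U F G B)
    (hz : IsFieldOn U Ω z) (hη : ContDiff ℝ ∞ η) :
    ContDiffOn ℝ ∞ (fun w : ℝ × Base => lagrangeDensity F G B (z + w.1 • η) w.2)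
      {w | w.2 ∈ Ω ∧ (z w.2 + w.1 • η w.2, w.2) ∈ U} := by
  set W : Set (ℝ × Base) := {w | w.2 ∈ Ω ∧ (z w.2 + w.1 • η w.2, w.2) ∈ U} with hWdef
  have hsnd : MapsTo Prod.snd W Ω := fun w hw => hw.1
  have hmap : ContDiffOn ℝ ∞ (fun w : ℝ × Base => ((z w.2 + w.1 • η w.2, w.2) : Total n)) W :=
    ((hz.smooth.comp contDiffOn_snd hsnd).add
      (contDiffOn_fst.smul (hη.contDiffOn.comp contDiffOn_snd hsnd))).prodMk contDiffOn_snd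
  have hc : ∀ {f : Total n → ℝ}, ContDiffOn ℝ ∞ f U →
      ContDiffOn ℝ ∞ (fun w : ℝ × Base => f (z w.2 + w.1 • η w.2, w.2)) W := fun hf =>
    hf.comp hmap (fun w hw => hw.2)
  have hF := contDiffOn_pi.1 hd.smoothF
  have hG := contDiffOn_pi.1 hd.smoothG
  have hT : ∀ ν, ContDiffOn ℝ ∞ (fun w : ℝ × Base => fieldT z w.2 ν + w.1 * fieldT η w.2 ν) W :=
    fun ν => ((hz.contDiffOn_fieldT ν).comp contDiffOn_snd hsnd).add
      (contDiffOn_fst.mul ((contDiff_fieldT hη ν).contDiffOn.comp contDiffOn_snd hsnd))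
  have hX : ∀ ν, ContDiffOn ℝ ∞ (fun w : ℝ × Base => fieldX z w.2 ν + w.1 * fieldX η w.2 ν) W :=
    fun ν => ((hz.contDiffOn_fieldX ν).comp contDiffOn_snd hsnd).add
      (contDiffOn_fst.mul ((contDiff_fieldX hη ν).contDiffOn.comp contDiffOn_snd hsnd))
  refine (((ContDiffOn.sum fun ν (_ : ν ∈ Finset.univ) => (hc (hF ν)).mul (hT ν)).add
    (ContDiffOn.sum fun ν (_ : ν ∈ Finset.univ) => (hc (hG ν)).mul (hX ν))).sub
      (hc hd.smoothB)).congr fun w hw => ?_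
  have hzd := (hz.hasFDerivAt hw.1).differentiableAt
  have hηd : DifferentiableAt ℝ η w.2 := hη.differentiable (by simp) w.2
  simp [lagrangeDensity, fieldT_add_smul hzd hηd, fieldX_add_smul hzd hηd]

theorem isOpen_variationDomain (hU : IsOpen U) (hz : IsFieldOn U Ω z) (hη : ContDiff ℝ ∞ η) :
    IsOpen {w : ℝ × Base | w.2 ∈ Ω ∧ (z w.2 + w.1 • η w.2, w.2) ∈ U} := by
  have hcont : ContinuousOn (fun w : ℝ × Base => ((z w.2 + w.1 • η w.2, w.2) : Total n))
      (Prod.snd ⁻¹' Ω) := by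
    have h1 : ContinuousOn (fun w : ℝ × Base => z w.2) (Prod.snd ⁻¹' Ω) :=
      hz.smooth.continuousOn.comp continuousOn_snd (fun w hw => hw)
    have h2 := hη.continuous
    exact (h1.add (by fun_prop)).prodMk continuousOn_snd
  exact hcont.isOpen_inter_preimage (hz.isOpen.preimage continuous_snd) hU

theorem IsFieldOn.contDiffOn_lagrangeDensity (hd : IsSmoothData U F G B)
    (hz : IsFieldOn U Ω z) : ContDiffOn ℝ ∞ (lagrangeDensity F G B z) Ω := by
  have hF := contDiffOn_pi.1 hd.smoothF
  have hG := contDiffOn_pi.1 hd.smoothG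
  exact ((ContDiffOn.sum fun ν _ => (hz.contDiffOn_comp (hF ν)).mul (hz.contDiffOn_fieldT ν)).add
    (ContDiffOn.sum fun ν _ => (hz.contDiffOn_comp (hG ν)).mul (hz.contDiffOn_fieldX ν))).sub
      (hz.contDiffOn_comp hd.smoothB)

end Density

/-! ### Linearization of the system -/

section System

variable {n : ℕ} {U : Set (Total n)} {Ω : Set Base} {z η : Base → Fin n → ℝ}
  {M K : Total n → Fin n → Fin n → ℝ} {D : Total n → Fin n → ℝ}

/-- Every component of the system is a Lagrange density. -/
theorem sysExpr_eq_lagrangeDensity (z : Base → Fin n → ℝ) (q : Base) (μ : Fin n) :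
    sysExpr M K D z q μ =
      lagrangeDensity (fun p => M p μ) (fun p => K p μ) (fun p => -D p μ) z q := by
  simp [sysExpr, lagrangeDensity]

theorem isSmoothData_component (hM : ContDiffOn ℝ ∞ M U) (hK : ContDiffOn ℝ ∞ K U)
    (hD : ContDiffOn ℝ ∞ D U) (μ : Fin n) :
    IsSmoothData U (fun p => M p μ) (fun p => K p μ) (fun p => -D p μ) :=
  ⟨contDiffOn_pi.1 hM μ, contDiffOn_pi.1 hK μ, (contDiffOn_pi.1 hD μ).neg⟩

theorem IsFieldOn.contDiffOn_sysExpr (hz : IsFieldOn U Ω z) (hM : ContDiffOn ℝ ∞ M U)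
    (hK : ContDiffOn ℝ ∞ K U) (hD : ContDiffOn ℝ ∞ D U) (μ : Fin n) :
    ContDiffOn ℝ ∞ (fun q => sysExpr M K D z q μ) Ω :=
  (hz.contDiffOn_lagrangeDensity (isSmoothData_component hM hK hD μ)).congr fun q _ =>
    sysExpr_eq_lagrangeDensity z q μ

/-- The coefficient of `η^ν` in the `μ`-th component of the variational form along `z`. -/
def zerothCoeff (M K : Total n → Fin n → Fin n → ℝ) (D : Total n → Fin n → ℝ)
    (z : Base → Fin n → ℝ) (q : Base) (μ ν : Fin n) : ℝ :=
  ∑ l, dz ν (fun r => M r μ l) (z q, q) * fieldT z q l +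
    ∑ l, dz ν (fun r => K r μ l) (z q, q) * fieldX z q l + dz ν (fun r => D r μ) (z q, q)

/-- Each component of the system is a Lagrange density with Birkhoffian `-D_μ`, so its linearization
is an instance of `densityVariation`. -/
theorem variationalForm_eq (hU : IsOpen U) (hz : IsFieldOn U Ω z) (hM : ContDiffOn ℝ ∞ M U)
    (hK : ContDiffOn ℝ ∞ K U) (hD : ContDiffOn ℝ ∞ D U) (hη : ContDiff ℝ ∞ η) {q : Base}
    (hq : q ∈ Ω) (μ : Fin n) :
    variationalForm M K D z η q μ = ∑ ν, M (z q, q) μ ν * fieldT η q ν +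
      ∑ ν, K (z q, q) μ ν * fieldX η q ν + ∑ ν, zerothCoeff M K D z q μ ν * η q ν := by
  have h := hasDerivAt_lagrangeDensity hU (isSmoothData_component hM hK hD μ) hz hη hq
  simp only [variationalForm, sysExpr_eq_lagrangeDensity]
  rw [h.deriv, densityVariation]
  simp only [zerothCoeff]
  have hneg : ∀ l, dz l (fun p => -D p μ) (z q, q) = -dz l (fun p => D p μ) (z q, q) := fun l => by
    simp [dz, fderiv_fun_neg]
  simp [hneg]

theorem IsFieldOn.contDiffOn_zerothCoeff (hU : IsOpen U) (hz : IsFieldOn U Ω z)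
    (hM : ContDiffOn ℝ ∞ M U) (hK : ContDiffOn ℝ ∞ K U) (hD : ContDiffOn ℝ ∞ D U)
    (μ ν : Fin n) : ContDiffOn ℝ ∞ (fun q => zerothCoeff M K D z q μ ν) Ω := by
  have hM' := fun i j => contDiffOn_pi.1 (contDiffOn_pi.1 hM i) j
  have hK' := fun i j => contDiffOn_pi.1 (contDiffOn_pi.1 hK i) j
  exact ((ContDiffOn.sum fun l _ => (hz.contDiffOn_comp (contDiffOn_dz hU (hM' μ l) ν)).mul
    (hz.contDiffOn_fieldT l)).add
    (ContDiffOn.sum fun l _ => (hz.contDiffOn_comp (contDiffOn_dz hU (hK' μ l) ν)).mul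
      (hz.contDiffOn_fieldX l))).add
    (hz.contDiffOn_comp (contDiffOn_dz hU (contDiffOn_pi.1 hD μ) ν))

end System

/-- The affine field through `p` with derivatives `a` in `x` and `b` in `t`. -/
def affineField {n : ℕ} (p : Total n) (a b : Fin n → ℝ) (q : Base) : Fin n → ℝ :=
  p.1 + (q.1 - p.2.1) • a + (q.2 - p.2.2) • b

/-! ### Fields with prescribed value and first derivatives at a point -/

section Affine

variable {n : ℕ} (p : Total n) (a b : Fin n → ℝ)

@[simp] theorem affineField_self : affineField p a b p.2 = p.1 := by simp [affineField]

theorem contDiff_affineField : ContDiff ℝ ∞ (affineField p a b) := by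
  unfold affineField
  fun_prop

theorem hasFDerivAt_affineField (q : Base) : HasFDerivAt (affineField p a b)
    ((ContinuousLinearMap.fst ℝ ℝ ℝ).smulRight a + (ContinuousLinearMap.snd ℝ ℝ ℝ).smulRight b)
    q := by
  have h1 : HasFDerivAt (fun q : Base => q.1 - p.2.1) (ContinuousLinearMap.fst ℝ ℝ ℝ) q :=
    hasFDerivAt_fst.sub_const _
  have h2 : HasFDerivAt (fun q : Base => q.2 - p.2.2) (ContinuousLinearMap.snd ℝ ℝ ℝ) q :=
    hasFDerivAt_snd.sub_const _
  exact ((h1.smul_const a).const_add p.1).add (h2.smul_const b)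

@[simp] theorem fieldX_affineField (q : Base) : fieldX (affineField p a b) q = a := by
  simp [fieldX, (hasFDerivAt_affineField p a b q).fderiv]

@[simp] theorem fieldT_affineField (q : Base) : fieldT (affineField p a b) q = b := by
  simp [fieldT, (hasFDerivAt_affineField p a b q).fderiv]

theorem isFieldOn_affineField {U : Set (Total n)} (hU : IsOpen U) :
    IsFieldOn U ((fun q => (affineField p a b q, q)) ⁻¹' U) (affineField p a b) :=
  ⟨hU.preimage ((contDiff_affineField p a b).continuous.prodMk continuous_id),
    (contDiff_affineField p a b).contDiffOn, fun _ hq => hq⟩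

end Affine

/-- An expression affine in two vectors vanishes only if all its coefficients do. -/
theorem coeff_eq_zero_of_affine {n : ℕ} {u v : Fin n → ℝ} {w : ℝ}
    (h : ∀ a b : Fin n → ℝ, ∑ l, u l * b l + ∑ l, v l * a l + w = 0) :
    u = 0 ∧ v = 0 ∧ w = 0 := by
  have hw : w = 0 := by simpa using h 0 0
  refine ⟨funext fun i => ?_, funext fun i => ?_, hw⟩
  · simpa [hw, Pi.single_apply] using h 0 (Pi.single i 1)
  · simpa [hw, Pi.single_apply] using h (Pi.single i 1) 0

/-! ### Self-adjointness is equivalent to closedness -/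

section SelfAdjoint

variable {n : ℕ} {U : Set (Total n)} {Ω : Set Base} {z ξ η : Base → Fin n → ℝ}
  {M K N : Total n → Fin n → Fin n → ℝ} {D : Total n → Fin n → ℝ}

/-- The pointwise conditions of self-adjointness: `M` and `K` are closed two-forms in `z`, and
their divergence in `(t, x)` is minus the exterior derivative of `D` in `z`. -/
structure IsClosedSystem (U : Set (Total n)) (M K : Total n → Fin n → Fin n → ℝ)
    (D : Total n → Fin n → ℝ) : Prop where
  skewM : ∀ p ∈ U, ∀ μ ν, M p μ ν + M p ν μ = 0
  skewK : ∀ p ∈ U, ∀ μ ν, K p μ ν + K p ν μ = 0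
  closedM : ∀ p ∈ U, ∀ μ ν l, dz l (fun r => M r μ ν) p - dz ν (fun r => M r μ l) p +
    dz μ (fun r => M r ν l) p = 0
  closedK : ∀ p ∈ U, ∀ μ ν l, dz l (fun r => K r μ ν) p - dz ν (fun r => K r μ l) p +
    dz μ (fun r => K r ν l) p = 0
  compat : ∀ p ∈ U, ∀ μ ν, dt (fun r => M r μ ν) p + dx (fun r => K r μ ν) p -
    dz ν (fun r => D r μ) p + dz μ (fun r => D r ν) p = 0

/-- The coefficient of `ξ^μ` in the `ν`-th component of the difference between the variational
form along `z` and its formal adjoint. -/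
def defectCoeff (M K : Total n → Fin n → Fin n → ℝ) (D : Total n → Fin n → ℝ)
    (z : Base → Fin n → ℝ) (q : Base) (μ ν : Fin n) : ℝ :=
  (∑ l, fieldT z q l * dz l (fun r => M r μ ν) (z q, q) + dt (fun r => M r μ ν) (z q, q)) +
    (∑ l, fieldX z q l * dz l (fun r => K r μ ν) (z q, q) + dx (fun r => K r μ ν) (z q, q)) -
    zerothCoeff M K D z q μ ν + zerothCoeff M K D z q ν μ

/-- The difference between the variational form along `z` and its formal adjoint, applied
to `ξ`. -/
def adjointDefect (M K : Total n → Fin n → Fin n → ℝ) (D : Total n → Fin n → ℝ)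
    (z ξ : Base → Fin n → ℝ) (q : Base) (ν : Fin n) : ℝ :=
  ∑ μ, ((M (z q, q) μ ν + M (z q, q) ν μ) * fieldT ξ q μ +
    (K (z q, q) μ ν + K (z q, q) ν μ) * fieldX ξ q μ + defectCoeff M K D z q μ ν * ξ q μ)

/-- Sorting by `z_t`, `z_x` and the constant term exhibits the coefficients as the left-hand sides
in `IsClosedSystem`, so both directions of the equivalence can be read off. -/
theorem defectCoeff_eq (q : Base) (μ ν : Fin n) : defectCoeff M K D z q μ ν =
    ∑ l, (dz l (fun r => M r μ ν) (z q, q) - dz ν (fun r => M r μ l) (z q, q) +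
      dz μ (fun r => M r ν l) (z q, q)) * fieldT z q l +
    ∑ l, (dz l (fun r => K r μ ν) (z q, q) - dz ν (fun r => K r μ l) (z q, q) +
      dz μ (fun r => K r ν l) (z q, q)) * fieldX z q l +
    (dt (fun r => M r μ ν) (z q, q) + dx (fun r => K r μ ν) (z q, q) -
      dz ν (fun r => D r μ) (z q, q) + dz μ (fun r => D r ν) (z q, q)) := by
  simp only [defectCoeff, zerothCoeff, add_mul, sub_mul, Finset.sum_add_distrib,
    Finset.sum_sub_distrib, mul_comm (fieldT z q _), mul_comm (fieldX z q _)]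
  ring

theorem IsClosedSystem.adjointDefect_eq_zero (h : IsClosedSystem U M K D) {q : Base}
    (hq : (z q, q) ∈ U) (ν : Fin n) : adjointDefect M K D z ξ q ν = 0 := by
  refine Finset.sum_eq_zero fun μ _ => ?_
  simp [defectCoeff_eq, h.skewM _ hq, h.skewK _ hq, h.closedM _ hq, h.closedK _ hq, h.compat _ hq]

/-- The bilinear density `ξ^μ N_{μν} η^ν` along the field `z`. -/
def pairing (N : Total n → Fin n → Fin n → ℝ) (z ξ η : Base → Fin n → ℝ) (q : Base) : ℝ :=
  ∑ μ, ∑ ν, ξ q μ * (N (z q, q) μ ν * η q ν)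

theorem fderiv_pairing (hU : IsOpen U) (hz : IsFieldOn U Ω z) (hN : ContDiffOn ℝ ∞ N U)
    (hξ : ContDiff ℝ ∞ ξ) (hη : ContDiff ℝ ∞ η) {q : Base} (hq : q ∈ Ω) (v : Base) :
    fderiv ℝ (pairing N z ξ η) q v = ∑ ν, ∑ μ, (fderiv ℝ ξ q v μ * (N (z q, q) μ ν * η q ν) +
      ξ q μ * (fderiv ℝ (fun q => N (z q, q) μ ν) q v * η q ν +
        N (z q, q) μ ν * fderiv ℝ η q v ν)) := by
  have hξd : DifferentiableAt ℝ ξ q := hξ.differentiable (by simp) q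
  have hηd : DifferentiableAt ℝ η q := hη.differentiable (by simp) q
  have hN' := fun i j => contDiffOn_pi.1 (contDiffOn_pi.1 hN i) j
  have hNd : ∀ i j, DifferentiableAt ℝ (fun q => N (z q, q) i j) q := fun i j =>
    (hz.hasFDerivAt_comp hU (hN' i j) hq).differentiableAt
  have h := HasFDerivAt.fun_sum (u := Finset.univ) fun μ _ =>
    HasFDerivAt.fun_sum (u := Finset.univ) fun ν _ =>
      (differentiableAt_pi.1 hξd μ).hasFDerivAt.mul
        ((hNd μ ν).hasFDerivAt.mul (differentiableAt_pi.1 hηd ν).hasFDerivAt)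
  have h' : HasFDerivAt (pairing N z ξ η) _ q := h
  rw [h'.fderiv, Finset.sum_comm]
  simp only [sum_apply, add_apply, smul_apply, smul_eq_mul, Pi.mul_apply, fderiv_coord hξd, fderiv_coord hηd]
  refine Finset.sum_congr rfl fun μ _ => Finset.sum_congr rfl fun ν _ => ?_
  ring

/-- Lagrange's identity for the variational form. -/
theorem lagrange_identity (hU : IsOpen U) (hz : IsFieldOn U Ω z) (hM : ContDiffOn ℝ ∞ M U)
    (hK : ContDiffOn ℝ ∞ K U) (hD : ContDiffOn ℝ ∞ D U) (hξ : ContDiff ℝ ∞ ξ)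
    (hη : ContDiff ℝ ∞ η) {q : Base} (hq : q ∈ Ω) :
    ∑ μ, ξ q μ * variationalForm M K D z η q μ - ∑ μ, η q μ * variationalForm M K D z ξ q μ =
      fderiv ℝ (pairing M z ξ η) q (0, 1) + fderiv ℝ (pairing K z ξ η) q (1, 0) -
        ∑ ν, η q ν * adjointDefect M K D z ξ q ν := by
  have hM' := fun i j => contDiffOn_pi.1 (contDiffOn_pi.1 hM i) j
  have hK' := fun i j => contDiffOn_pi.1 (contDiffOn_pi.1 hK i) j
  have e1 : ∑ μ, ξ q μ * variationalForm M K D z η q μ = ∑ ν, ∑ μ, ξ q μ *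
      (M (z q, q) μ ν * fieldT η q ν + K (z q, q) μ ν * fieldX η q ν +
        zerothCoeff M K D z q μ ν * η q ν) := by
    rw [Finset.sum_comm]
    refine Finset.sum_congr rfl fun μ _ => ?_
    rw [variationalForm_eq hU hz hM hK hD hη hq, ← Finset.mul_sum]
    simp only [Finset.sum_add_distrib]
  have e2 : ∑ ν, η q ν * variationalForm M K D z ξ q ν = ∑ ν, ∑ μ, η q ν *
      (M (z q, q) ν μ * fieldT ξ q μ + K (z q, q) ν μ * fieldX ξ q μ +
        zerothCoeff M K D z q ν μ * ξ q μ) := by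
    refine Finset.sum_congr rfl fun ν _ => ?_
    rw [variationalForm_eq hU hz hM hK hD hξ hq, ← Finset.mul_sum]
    simp only [Finset.sum_add_distrib]
  rw [e1, e2, fderiv_pairing hU hz hM hξ hη hq, fderiv_pairing hU hz hK hξ hη hq]
  simp only [adjointDefect, Finset.mul_sum, ← Finset.sum_add_distrib, ← Finset.sum_sub_distrib]
  refine Finset.sum_congr rfl fun ν _ => Finset.sum_congr rfl fun μ _ => ?_
  rw [hz.fderiv_comp_t hU (hM' μ ν) hq, hz.fderiv_comp_x hU (hK' μ ν) hq, defectCoeff]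
  simp only [fieldT, fieldX]
  ring

theorem contDiff_pairing (hz : IsFieldOn U Ω z) (hN : ContDiffOn ℝ ∞ N U) (hξ : IsTestOn Ω ξ)
    (hη : ContDiff ℝ ∞ η) : ContDiff ℝ ∞ (pairing N z ξ η) := by
  have hN' := fun i j => contDiffOn_pi.1 (contDiffOn_pi.1 hN i) j
  refine ContDiff.sum fun μ _ => ContDiff.sum fun ν _ => ?_
  exact contDiff_mul_of_tsupport_subset hz.isOpen (contDiff_pi.1 hξ.smooth μ)
    ((tsupport_apply_subset ξ μ).trans hξ.support)
    ((hz.contDiffOn_comp (hN' μ ν)).mul (contDiff_pi.1 hη ν).contDiffOn)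

theorem support_pairing_subset : Function.support (pairing N z ξ η) ⊆ Function.support ξ := by
  intro q hq h0
  exact hq (by simp [pairing, h0])

theorem hasCompactSupport_pairing (hξ : IsTestOn Ω ξ) :
    HasCompactSupport (pairing N z ξ η) :=
  hξ.compact.of_isClosed_subset (isClosed_tsupport _) (closure_mono support_pairing_subset)

theorem integrable_mul_variationalForm (hU : IsOpen U) (hz : IsFieldOn U Ω z)
    (hM : ContDiffOn ℝ ∞ M U) (hK : ContDiffOn ℝ ∞ K U) (hD : ContDiffOn ℝ ∞ D U)
    (hξ : IsTestOn Ω ξ) (hη : ContDiff ℝ ∞ η) :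
    Integrable (fun q => ∑ μ, ξ q μ * variationalForm M K D z η q μ) := by
  have hM' := fun i j => contDiffOn_pi.1 (contDiffOn_pi.1 hM i) j
  have hK' := fun i j => contDiffOn_pi.1 (contDiffOn_pi.1 hK i) j
  refine integrable_finsetSum _ fun μ _ => integrable_mul_of_isTestOn_apply hz.isOpen hξ μ ?_
  refine ContDiffOn.congr ?_ fun q hq => variationalForm_eq hU hz hM hK hD hη hq μ
  exact ((ContDiffOn.sum fun ν _ => (hz.contDiffOn_comp (hM' μ ν)).mul
      (contDiff_fieldT hη ν).contDiffOn).add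
    (ContDiffOn.sum fun ν _ => (hz.contDiffOn_comp (hK' μ ν)).mul
      (contDiff_fieldX hη ν).contDiffOn)).add
    (ContDiffOn.sum fun ν _ => (hz.contDiffOn_zerothCoeff hU hM hK hD μ ν).mul
      (contDiff_pi.1 hη ν).contDiffOn)

theorem contDiffOn_adjointDefect (hU : IsOpen U) (hz : IsFieldOn U Ω z)
    (hM : ContDiffOn ℝ ∞ M U) (hK : ContDiffOn ℝ ∞ K U) (hD : ContDiffOn ℝ ∞ D U)
    (hξ : ContDiff ℝ ∞ ξ) (ν : Fin n) :
    ContDiffOn ℝ ∞ (fun q => adjointDefect M K D z ξ q ν) Ω := by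
  have hM' := fun i j => contDiffOn_pi.1 (contDiffOn_pi.1 hM i) j
  have hK' := fun i j => contDiffOn_pi.1 (contDiffOn_pi.1 hK i) j
  have hdef : ∀ μ, ContDiffOn ℝ ∞ (fun q => defectCoeff M K D z q μ ν) Ω := fun μ =>
    ((((ContDiffOn.sum fun l _ => (hz.contDiffOn_fieldT l).mul
        (hz.contDiffOn_comp (contDiffOn_dz hU (hM' μ ν) l))).add
        (hz.contDiffOn_comp (contDiffOn_dt hU (hM' μ ν)))).add
      ((ContDiffOn.sum fun l _ => (hz.contDiffOn_fieldX l).mul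
        (hz.contDiffOn_comp (contDiffOn_dz hU (hK' μ ν) l))).add
        (hz.contDiffOn_comp (contDiffOn_dx hU (hK' μ ν))))).sub
      (hz.contDiffOn_zerothCoeff hU hM hK hD μ ν)).add
      (hz.contDiffOn_zerothCoeff hU hM hK hD ν μ)
  exact ContDiffOn.sum fun μ _ => ((((hz.contDiffOn_comp (hM' μ ν)).add
    (hz.contDiffOn_comp (hM' ν μ))).mul (contDiff_fieldT hξ μ).contDiffOn).add
    (((hz.contDiffOn_comp (hK' μ ν)).add
    (hz.contDiffOn_comp (hK' ν μ))).mul (contDiff_fieldX hξ μ).contDiffOn)).add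
    ((hdef μ).mul (contDiff_pi.1 hξ μ).contDiffOn)

/-- Green's formula for the variational form. -/
theorem integral_variationalForm_sub (hU : IsOpen U) (hz : IsFieldOn U Ω z)
    (hM : ContDiffOn ℝ ∞ M U) (hK : ContDiffOn ℝ ∞ K U) (hD : ContDiffOn ℝ ∞ D U)
    (hξ : IsTestOn Ω ξ) (hη : IsTestOn Ω η) :
    (∫ q, ∑ μ, ξ q μ * variationalForm M K D z η q μ) -
      ∫ q, ∑ μ, η q μ * variationalForm M K D z ξ q μ =
      -∫ q, ∑ ν, η q ν * adjointDefect M K D z ξ q ν := by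
  rw [← integral_sub (integrable_mul_variationalForm hU hz hM hK hD hξ hη.smooth)
    (integrable_mul_variationalForm hU hz hM hK hD hη hξ.smooth)]
  -- Outside `Ω` nothing is known about `z`, but there `ξ` and `η` vanish, and the pairings vanish
  -- in a neighbourhood, so both sides are zero.
  have hpt : ∀ q, ∑ μ, ξ q μ * variationalForm M K D z η q μ -
      ∑ μ, η q μ * variationalForm M K D z ξ q μ =
      fderiv ℝ (pairing M z ξ η) q (0, 1) + fderiv ℝ (pairing K z ξ η) q (1, 0) -
        ∑ ν, η q ν * adjointDefect M K D z ξ q ν := by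
    intro q
    by_cases hq : q ∈ Ω
    · exact lagrange_identity hU hz hM hK hD hξ.smooth hη.smooth hq
    · have hξ0 : q ∉ tsupport ξ := fun h => hq (hξ.support h)
      have hη0 : q ∉ tsupport η := fun h => hq (hη.support h)
      have hp : ∀ N : Total n → Fin n → Fin n → ℝ, fderiv ℝ (pairing N z ξ η) q = 0 := fun N => by
        have : q ∉ tsupport (pairing N z ξ η) := fun h =>
          hξ0 (closure_mono support_pairing_subset h)
        rw [(notMem_tsupport_iff_eventuallyEq.1 this).fderiv_eq]
        simp
      simp [hp, image_eq_zero_of_notMem_tsupport hξ0, image_eq_zero_of_notMem_tsupport hη0]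
  have hint : ∀ {N : Total n → Fin n → Fin n → ℝ} (v : Base), ContDiffOn ℝ ∞ N U →
      Integrable (fun q => fderiv ℝ (pairing N z ξ η) q v) := fun v hN =>
    (((contDiff_pairing hz hN hξ hη.smooth).continuous_fderiv (by simp)).clm_apply
      continuous_const).integrable_of_hasCompactSupport
      ((hasCompactSupport_pairing hξ).fderiv_apply ℝ v)
  have hdef : Integrable (fun q => ∑ ν, η q ν * adjointDefect M K D z ξ q ν) :=
    integrable_finsetSum _ fun ν _ => integrable_mul_of_isTestOn_apply hz.isOpen hη ν
      (contDiffOn_adjointDefect hU hz hM hK hD hξ.smooth ν)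
  have hMK : Integrable (fun q => fderiv ℝ (pairing M z ξ η) q (0, 1) +
      fderiv ℝ (pairing K z ξ η) q (1, 0)) := (hint _ hM).add (hint _ hK)
  simp only [hpt]
  rw [integral_sub hMK hdef, integral_add (hint _ hM) (hint _ hK),
    integral_fderiv_eq_zero (contDiff_pairing hz hM hξ hη.smooth) (hasCompactSupport_pairing hξ),
    integral_fderiv_eq_zero (contDiff_pairing hz hK hξ hη.smooth) (hasCompactSupport_pairing hξ)]
  ring

theorem IsClosedSystem.isSelfAdjointOn (hU : IsOpen U) (hM : ContDiffOn ℝ ∞ M U)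
    (hK : ContDiffOn ℝ ∞ K U) (hD : ContDiffOn ℝ ∞ D U) (h : IsClosedSystem U M K D) :
    IsSelfAdjointOn U M K D := by
  intro Ω z hz ξ η hξ hη
  rw [← sub_eq_zero, integral_variationalForm_sub hU hz hM hK hD hξ hη, neg_eq_zero]
  refine integral_eq_zero_of_ae (Eventually.of_forall fun q => ?_)
  refine Finset.sum_eq_zero fun ν _ => ?_
  by_cases hq : q ∈ Ω
  · rw [h.adjointDefect_eq_zero (hz.graph q hq), mul_zero]
  · simp [image_eq_zero_of_notMem_tsupport fun h => hq (hη.support h)]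

theorem isTestOn_single {g : Base → ℝ} (hg : ContDiff ℝ ∞ g) (hc : HasCompactSupport g)
    (hs : tsupport g ⊆ Ω) (ν : Fin n) :
    IsTestOn Ω (fun q => Pi.single ν (g q) : Base → Fin n → ℝ) := by
  have hsub : tsupport (fun q => Pi.single ν (g q) : Base → Fin n → ℝ) ⊆ tsupport g := by
    refine closure_mono fun q hq h0 => hq ?_
    simp [h0]
  refine ⟨contDiff_pi.2 fun i => ?_, hc.of_isClosed_subset (isClosed_tsupport _) hsub,
    hsub.trans hs⟩
  by_cases h : i = ν
  · subst h; simpa using hg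
  · simpa [h] using contDiff_const

/-- Green's formula with `η` concentrated in the single component `ν` tests that component of the
defect against an arbitrary scalar function. -/
theorem IsSelfAdjointOn.adjointDefect_eq_zero (hU : IsOpen U) (hM : ContDiffOn ℝ ∞ M U)
    (hK : ContDiffOn ℝ ∞ K U) (hD : ContDiffOn ℝ ∞ D U) (h : IsSelfAdjointOn U M K D)
    (hz : IsFieldOn U Ω z) (hξ : IsTestOn Ω ξ) (ν : Fin n) :
    ∀ q ∈ Ω, adjointDefect M K D z ξ q ν = 0 := by
  refine eqOn_zero_of_integral_mul_eq_zero (μ := volume) hz.isOpen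
    (contDiffOn_adjointDefect hU hz hM hK hD hξ.smooth ν).continuousOn fun g hg hc hs => ?_
  have hη := isTestOn_single hg hc hs ν
  have h1 := integral_variationalForm_sub hU hz hM hK hD hξ hη
  rw [h Ω z hz ξ _ hξ hη, sub_self, eq_comm, neg_eq_zero] at h1
  simpa [Pi.single_apply] using h1

theorem IsSelfAdjointOn.isClosedSystem (hU : IsOpen U) (hM : ContDiffOn ℝ ∞ M U)
    (hK : ContDiffOn ℝ ∞ K U) (hD : ContDiffOn ℝ ∞ D U) (h : IsSelfAdjointOn U M K D) :
    IsClosedSystem U M K D := by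
  -- Here `a, b` are the derivatives of the field at `p` in `x` and `t`, and `c, d, e` are the value
  -- and the two derivatives of `ξ`. All five are independent, since cutting off an affine map
  -- preserves its germ.
  have key : ∀ p ∈ U, ∀ a b c d e : Fin n → ℝ, ∀ ν,
      ∑ μ, ((M p μ ν + M p ν μ) * e μ + (K p μ ν + K p ν μ) * d μ +
        defectCoeff M K D (affineField p a b) p.2 μ ν * c μ) = 0 := by
    intro p hp a b c d e ν
    have hz := isFieldOn_affineField p a b hU
    have hq : p.2 ∈ (fun q => (affineField p a b q, q)) ⁻¹' U := by simpa using hp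
    obtain ⟨ξ, hξ, hξe⟩ := exists_isTestOn_eventuallyEq hz.isOpen hq
      (contDiff_affineField (c, p.2) d e)
    have h0 := h.adjointDefect_eq_zero hU hM hK hD hz hξ ν p.2 hq
    have hv : ξ p.2 = c := hξe.eq_of_nhds.trans (affineField_self (c, p.2) d e)
    have hT : fieldT ξ p.2 = e := by
      rw [fieldT, hξe.fderiv_eq]; exact fieldT_affineField (c, p.2) d e p.2
    have hX : fieldX ξ p.2 = d := by
      rw [fieldX, hξe.fderiv_eq]; exact fieldX_affineField (c, p.2) d e p.2
    simpa [adjointDefect, hv, hT, hX] using h0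
  have hcoef : ∀ p ∈ U, ∀ μ ν, ∀ a b, defectCoeff M K D (affineField p a b) p.2 μ ν = 0 := by
    intro p hp μ ν a b
    simpa [Pi.single_apply] using key p hp a b (Pi.single μ 1) 0 0 ν
  -- The defect coefficient vanishes for all `a, b` and is affine in them, so its three groups of
  -- coefficients vanish separately.
  have hall : ∀ p ∈ U, ∀ μ ν, _ := fun p hp μ ν =>
    coeff_eq_zero_of_affine fun a b => by
      have := hcoef p hp μ ν a b
      simpa only [defectCoeff_eq, affineField_self, fieldT_affineField, fieldX_affineField]
        using this
  refine ⟨fun p hp μ ν => ?_, fun p hp μ ν => ?_, fun p hp μ ν l => ?_, fun p hp μ ν l => ?_,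
    fun p hp μ ν => (hall p hp μ ν).2.2⟩
  · simpa [Pi.single_apply] using key p hp 0 0 0 0 (Pi.single μ 1) ν
  · simpa [Pi.single_apply] using key p hp 0 0 0 (Pi.single μ 1) 0 ν
  · exact congrFun (hall p hp μ ν).1 l
  · exact congrFun (hall p hp μ ν).2.1 l

theorem isSelfAdjointOn_iff_isClosedSystem (hU : IsOpen U) (hM : ContDiffOn ℝ ∞ M U)
    (hK : ContDiffOn ℝ ∞ K U) (hD : ContDiffOn ℝ ∞ D U) :
    IsSelfAdjointOn U M K D ↔ IsClosedSystem U M K D :=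
  ⟨fun h => h.isClosedSystem hU hM hK hD, fun h => h.isSelfAdjointOn hU hM hK hD⟩

end SelfAdjoint

/-! ### Birkhoff systems are closed -/

section BirkhoffClosed

variable {n : ℕ} {U V : Set (Total n)} {f g : Total n → ℝ}
  {M K : Total n → Fin n → Fin n → ℝ} {D : Total n → Fin n → ℝ}
  {F G : Total n → Fin n → ℝ} {B : Total n → ℝ}

theorem fderiv_fderiv_comm (hU : IsOpen U) (hf : ContDiffOn ℝ ∞ f U) {p : Total n} (hp : p ∈ U)
    (v w : Total n) : fderiv ℝ (fun r => fderiv ℝ f r v) p w =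
      fderiv ℝ (fun r => fderiv ℝ f r w) p v := by
  have hd : DifferentiableAt ℝ (fderiv ℝ f) p :=
    ((hf.fderiv_of_isOpen hU (m := ∞) (by simp)).hasFDerivAt_fderiv_of_isOpen hU hp).differentiableAt
  have h1 : ∀ v w, fderiv ℝ (fun r => fderiv ℝ f r v) p w = fderiv ℝ (fderiv ℝ f) p w v :=
    fun v w => by
      rw [fderiv_clm_apply hd (differentiableAt_const v)]
      simp
  rw [h1, h1]
  exact ((hf.contDiffAt (hU.mem_nhds hp)).isSymmSndFDerivAt
    (by rw [minSmoothness_of_isRCLikeNormedField]; exact WithTop.coe_le_coe.2 le_top)).eq w v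

theorem fderiv_congr_of_eqOn (hU : IsOpen U) (h : EqOn f g U) {p : Total n} (hp : p ∈ U) :
    fderiv ℝ f p = fderiv ℝ g p :=
  (h.eventuallyEq_of_mem (hU.mem_nhds hp)).fderiv_eq

theorem fderiv_sub_apply_of_contDiffOn (hU : IsOpen U) (hf : ContDiffOn ℝ ∞ f U)
    (hg : ContDiffOn ℝ ∞ g U) {p : Total n} (hp : p ∈ U) (v : Total n) :
    fderiv ℝ (fun r => f r - g r) p v = fderiv ℝ f p v - fderiv ℝ g p v := by
  rw [((hf.hasFDerivAt_fderiv_of_isOpen hU hp).fun_sub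
    (hg.hasFDerivAt_fderiv_of_isOpen hU hp)).fderiv]
  rfl

theorem fderiv_add_apply_of_contDiffOn (hU : IsOpen U) (hf : ContDiffOn ℝ ∞ f U)
    (hg : ContDiffOn ℝ ∞ g U) {p : Total n} (hp : p ∈ U) (v : Total n) :
    fderiv ℝ (fun r => f r + g r) p v = fderiv ℝ f p v + fderiv ℝ g p v := by
  rw [((hf.hasFDerivAt_fderiv_of_isOpen hU hp).fun_add
    (hg.hasFDerivAt_fderiv_of_isOpen hU hp)).fderiv]
  rfl

/-- Derivatives of the exterior derivative (in `z`) of a one-form. -/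
theorem fderiv_curl (hU : IsOpen U) (hF : ContDiffOn ℝ ∞ F U) {N : Total n → Fin n → Fin n → ℝ}
    (hN : ∀ p ∈ U, ∀ μ ν, N p μ ν = dz μ (fun r => F r ν) p - dz ν (fun r => F r μ) p)
    {p : Total n} (hp : p ∈ U) (μ ν : Fin n) (v : Total n) :
    fderiv ℝ (fun r => N r μ ν) p v =
      fderiv ℝ (dz μ (fun r => F r ν)) p v - fderiv ℝ (dz ν (fun r => F r μ)) p v := by
  have hF' := contDiffOn_pi.1 hF
  rw [fderiv_congr_of_eqOn hU (fun r hr => hN r hr μ ν) hp,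
    fderiv_sub_apply_of_contDiffOn hU (contDiffOn_dz hU (hF' ν) μ) (contDiffOn_dz hU (hF' μ) ν) hp]

/-- This is `d ∘ d = 0`: the six second derivatives cancel in pairs once the order of
differentiation is exchanged. -/
theorem closed_of_curl (hU : IsOpen U) (hF : ContDiffOn ℝ ∞ F U)
    {N : Total n → Fin n → Fin n → ℝ}
    (hN : ∀ p ∈ U, ∀ μ ν, N p μ ν = dz μ (fun r => F r ν) p - dz ν (fun r => F r μ) p)
    {p : Total n} (hp : p ∈ U) (μ ν l : Fin n) :
    dz l (fun r => N r μ ν) p - dz ν (fun r => N r μ l) p + dz μ (fun r => N r ν l) p = 0 := by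
  have hF' := contDiffOn_pi.1 hF
  have h : ∀ i j k, dz i (fun r => N r j k) p = dz i (dz j (fun r => F r k)) p -
      dz i (dz k (fun r => F r j)) p := fun i j k => fderiv_curl hU hF hN hp j k _
  have hc : ∀ i j k, dz i (dz j (fun r => F r k)) p = dz j (dz i (fun r => F r k)) p :=
    fun i j k => fderiv_fderiv_comm hU (hF' k) hp _ _
  rw [h, h, h, hc l μ ν, hc l ν μ, hc ν μ l]
  ring

theorem IsBirkhoffRepr.isClosedSystem (hU : IsOpen U) (hd : IsSmoothData U F G B)
    (h : IsBirkhoffRepr U M K D F G B) : IsClosedSystem U M K D := by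
  have hF := contDiffOn_pi.1 hd.smoothF
  have hG := contDiffOn_pi.1 hd.smoothG
  refine ⟨fun p hp μ ν => ?_, fun p hp μ ν => ?_,
    fun p hp => closed_of_curl hU hd.smoothF h.eqM hp,
    fun p hp => closed_of_curl hU hd.smoothG h.eqK hp, fun p hp μ ν => ?_⟩
  · rw [h.eqM p hp, h.eqM p hp]; ring
  · rw [h.eqK p hp, h.eqK p hp]; ring
  · have hDd : ∀ i j, dz i (fun r => D r j) p = -(dz i (dz j B) p +
        dz i (dt (fun r => F r j)) p + dz i (dx (fun r => G r j)) p) := fun i j => by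
      have h1 := contDiffOn_dz hU hd.smoothB j
      have h2 := contDiffOn_dt hU (hF j)
      have h3 := contDiffOn_dx hU (hG j)
      unfold dz
      rw [fderiv_congr_of_eqOn hU (fun r hr => h.eqD r hr j) hp, fderiv_fun_neg,
        neg_apply, fderiv_add_apply_of_contDiffOn hU (h1.add h2) h3 hp,
        fderiv_add_apply_of_contDiffOn hU h1 h2 hp]
      rfl
    have hM : dt (fun r => M r μ ν) p = dt (dz μ (fun r => F r ν)) p -
      dt (dz ν (fun r => F r μ)) p := fderiv_curl hU hd.smoothF h.eqM hp μ ν _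
    have hK : dx (fun r => K r μ ν) p = dx (dz μ (fun r => G r ν)) p -
      dx (dz ν (fun r => G r μ)) p := fderiv_curl hU hd.smoothG h.eqK hp μ ν _
    have cB : dz ν (dz μ B) p = dz μ (dz ν B) p := fderiv_fderiv_comm hU hd.smoothB hp _ _
    have cF : ∀ i j, dt (dz i (fun r => F r j)) p = dz i (dt (fun r => F r j)) p :=
      fun i j => fderiv_fderiv_comm hU (hF j) hp _ _
    have cG : ∀ i j, dx (dz i (fun r => G r j)) p = dz i (dx (fun r => G r j)) p :=
      fun i j => fderiv_fderiv_comm hU (hG j) hp _ _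
    rw [hM, hK, hDd, hDd, cB, cF, cF, cG, cG]
    ring

end BirkhoffClosed

/-! ### Poincaré's lemma in `z` with parameters `(x, t)` -/

section Homotopy

variable {n : ℕ} {U : Set (Total n)} {c : Base → Fin n → ℝ} {f : Total n → ℝ}
  {g : Fin n → Total n → ℝ}

/-- The contraction of the slices of `U` onto the centres `c`. -/
def contraction (c : Base → Fin n → ℝ) (w : Total n × ℝ) : Total n :=
  (c w.1.2 + w.2 • (w.1.1 - c w.1.2), w.1.2)

/-- The domain on which the contraction is smooth with values in `U`. -/
def contractionDomain (U : Set (Total n)) (c : Base → Fin n → ℝ) : Set (Total n × ℝ) :=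
  {w | w.1.2 ∈ Prod.snd '' U ∧ contraction c w ∈ U}

@[simp] theorem contraction_one (p : Total n) : contraction c (p, 1) = p := by
  simp [contraction]

theorem isOpen_snd_image (hU : IsOpen U) : IsOpen (Prod.snd '' U) := isOpenMap_snd U hU

theorem contDiffOn_contraction (hc : ContDiffOn ℝ ∞ c (Prod.snd '' U)) :
    ContDiffOn ℝ ∞ (contraction c) {w | w.1.2 ∈ Prod.snd '' U} := by
  have hq : ContDiff ℝ ∞ (fun w : Total n × ℝ => w.1.2) := by fun_prop
  have h1 : ContDiffOn ℝ ∞ (fun w : Total n × ℝ => c w.1.2) {w | w.1.2 ∈ Prod.snd '' U} :=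
    hc.comp hq.contDiffOn (fun w hw => hw)
  exact (h1.add (contDiffOn_snd.smul ((contDiff_fst.fst).contDiffOn.sub h1))).prodMk hq.contDiffOn

theorem isOpen_contractionDomain (hU : IsOpen U) (hc : ContDiffOn ℝ ∞ c (Prod.snd '' U)) :
    IsOpen (contractionDomain U c) :=
  (contDiffOn_contraction hc).continuousOn.isOpen_inter_preimage
    ((isOpen_snd_image hU).preimage (by fun_prop)) hU

theorem prod_subset_contractionDomain
    (hs : ∀ q ∈ Prod.snd '' U, StarConvex ℝ (c q) {z | (z, q) ∈ U}) :
    U ×ˢ Icc (0 : ℝ) 1 ⊆ contractionDomain U c := by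
  rintro ⟨⟨z, q⟩, s⟩ ⟨hp, h0, h1⟩
  have hq : q ∈ Prod.snd '' U := ⟨_, hp, rfl⟩
  refine ⟨hq, ?_⟩
  have := hs q hq (y := z) hp (sub_nonneg.2 h1) h0 (by ring)
  have e : c q + s • (z - c q) = (1 - s) • c q + s • z := by module
  simpa [contraction, e] using this

theorem hasDerivAt_contraction (p : Total n) (s : ℝ) :
    HasDerivAt (fun s => contraction c (p, s)) (p.1 - c p.2, (0, 0)) s := by
  refine HasDerivAt.prodMk ?_ (hasDerivAt_const s p.2)
  simpa using ((hasDerivAt_id s).smul_const (p.1 - c p.2)).const_add (c p.2)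

theorem continuous_contraction (p : Total n) : Continuous fun s => contraction c (p, s) :=
  continuous_iff_continuousAt.2 fun s => (hasDerivAt_contraction p s).continuousAt

theorem continuousOn_comp_contraction
    (hs : ∀ q ∈ Prod.snd '' U, StarConvex ℝ (c q) {z | (z, q) ∈ U})
    (hf : ContinuousOn f U) {p : Total n} (hp : p ∈ U) :
    ContinuousOn (fun s => f (contraction c (p, s))) (Icc 0 1) :=
  hf.comp (continuous_contraction p).continuousOn fun _ h =>
    (prod_subset_contractionDomain hs ⟨hp, h⟩).2

/-- The integrand of the homotopy operator. -/
def homotopyIntegrand (c : Base → Fin n → ℝ) (k : ℕ) (g : Fin n → Total n → ℝ)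
    (w : Total n × ℝ) : ℝ :=
  ∑ μ, w.2 ^ k * g μ (contraction c w) * (w.1.1 μ - c w.1.2 μ)

/-- The homotopy operator of Poincaré's lemma, with parameters `(x, t)`. -/
def homotopy (c : Base → Fin n → ℝ) (k : ℕ) (g : Fin n → Total n → ℝ) (p : Total n) : ℝ :=
  ∫ s in Icc (0 : ℝ) 1, homotopyIntegrand c k g (p, s)

theorem contDiffOn_homotopyIntegrand (hc : ContDiffOn ℝ ∞ c (Prod.snd '' U)) (k : ℕ)
    (hg : ∀ μ, ContDiffOn ℝ ∞ (g μ) U) :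
    ContDiffOn ℝ ∞ (homotopyIntegrand c k g) (contractionDomain U c) := by
  have hq : ContDiff ℝ ∞ (fun w : Total n × ℝ => w.1.2) := by fun_prop
  have h1 : ContDiffOn ℝ ∞ (fun w : Total n × ℝ => c w.1.2) (contractionDomain U c) :=
    hc.comp hq.contDiffOn (fun w hw => hw.1)
  refine ContDiffOn.sum fun μ _ => ((contDiffOn_snd.pow k).mul ?_).mul ?_
  · exact (hg μ).comp ((contDiffOn_contraction hc).mono fun w hw => hw.1) fun w hw => hw.2
  · exact (contDiff_pi.1 (contDiff_fst.fst) μ).contDiffOn.sub (contDiffOn_pi.1 h1 μ)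

theorem contDiffOn_homotopy (hU : IsOpen U) (hc : ContDiffOn ℝ ∞ c (Prod.snd '' U))
    (hs : ∀ q ∈ Prod.snd '' U, StarConvex ℝ (c q) {z | (z, q) ∈ U}) (k : ℕ)
    (hg : ∀ μ, ContDiffOn ℝ ∞ (g μ) U) : ContDiffOn ℝ ∞ (homotopy c k g) U :=
  contDiffOn_integral hU (isOpen_contractionDomain hU hc) isCompact_Icc
    (prod_subset_contractionDomain hs) (contDiffOn_homotopyIntegrand hc k hg)

/-- Moving `p` in a `z`-direction leaves `c p.2` fixed and moves the contracted point with speed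
`s`. This accounts for the extra power of `s`, and no derivative of `c` appears. -/
theorem fderiv_homotopyIntegrand (hU : IsOpen U) (hc : ContDiffOn ℝ ∞ c (Prod.snd '' U)) (k : ℕ)
    (hg : ∀ μ, ContDiffOn ℝ ∞ (g μ) U) {p : Total n} {s : ℝ}
    (hw : (p, s) ∈ contractionDomain U c) (α : Fin n) :
    fderiv ℝ (homotopyIntegrand c k g) (p, s) ((Pi.single α 1, (0, 0)), 0) =
      s ^ k * g α (contraction c (p, s)) +
        ∑ μ, s ^ (k + 1) * dz α (g μ) (contraction c (p, s)) * (p.1 μ - c p.2 μ) := by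
  have h1 := ((contDiffOn_homotopyIntegrand hc k hg).hasFDerivAt_fderiv_of_isOpen
    (isOpen_contractionDomain hU hc) hw).hasLineDerivAt ((Pi.single α 1, (0, 0)), 0)
  have hline : ∀ τ : ℝ, ((p, s) : Total n × ℝ) + τ • ((Pi.single α 1, (0, 0)), 0) =
      ((p.1 + τ • Pi.single α 1, p.2), s) := fun τ => by
    refine Prod.ext (Prod.ext ?_ ?_) ?_ <;> simp
  have hcon : HasDerivAt (fun τ : ℝ => contraction c ((p.1 + τ • Pi.single α 1, p.2), s))
      (s • (Pi.single α 1, (0, 0))) 0 := by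
    have h2 : HasDerivAt (fun τ : ℝ => c p.2 + s • (p.1 + τ • Pi.single α (1 : ℝ) - c p.2))
        (s • Pi.single α 1) 0 := by
      have := ((hasDerivAt_id (0 : ℝ)).smul_const (Pi.single α (1 : ℝ) : Fin n → ℝ))
      simpa using (((this.const_add p.1).sub_const (c p.2)).const_smul s).const_add (c p.2)
    have h3 := h2.prodMk (hasDerivAt_const (0 : ℝ) p.2)
    refine h3.congr_deriv ?_
    refine Prod.ext ?_ ?_
    · simp
    · simp [Prod.zero_eq_mk]
  have hgd : ∀ μ, HasDerivAt
      (fun τ : ℝ => g μ (contraction c ((p.1 + τ • Pi.single α 1, p.2), s)))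
      (s * dz α (g μ) (contraction c (p, s))) 0 := fun μ => by
    have h4 := (hg μ).hasFDerivAt_fderiv_of_isOpen hU hw.2
    have h5 : HasFDerivAt (g μ) (fderiv ℝ (g μ) (contraction c (p, s)))
        (contraction c ((p.1 + (0 : ℝ) • Pi.single α 1, p.2), s)) := by simpa using h4
    have := h5.comp_hasDerivAt (0 : ℝ) hcon
    rw [map_smul, smul_eq_mul] at this
    exact this
  have hpd : ∀ μ, HasDerivAt
      (fun τ : ℝ => (p.1 + τ • (Pi.single α 1 : Fin n → ℝ)) μ - c p.2 μ)
      ((Pi.single α 1 : Fin n → ℝ) μ) 0 := fun μ => by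
    simpa using (((hasDerivAt_id (0 : ℝ)).mul_const
      ((Pi.single α 1 : Fin n → ℝ) μ)).const_add (p.1 μ)).sub_const (c p.2 μ)
  have h6 := HasDerivAt.fun_sum (u := Finset.univ) fun μ _ =>
    ((hgd μ).const_mul (s ^ k)).mul (hpd μ)
  have h7 : HasDerivAt (fun τ : ℝ => homotopyIntegrand c k g ((p.1 + τ • Pi.single α 1, p.2), s))
      (fderiv ℝ (homotopyIntegrand c k g) (p, s) ((Pi.single α 1, (0, 0)), 0)) 0 := by
    simpa only [HasLineDerivAt, hline] using h1
  rw [h7.unique h6]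
  simp only [zero_smul, add_zero, Finset.sum_add_distrib]
  rw [add_comm]
  congr 1
  · simp [Pi.single_apply]
  · refine Finset.sum_congr rfl fun μ _ => ?_
    ring

theorem dz_homotopy (hU : IsOpen U) (hc : ContDiffOn ℝ ∞ c (Prod.snd '' U))
    (hs : ∀ q ∈ Prod.snd '' U, StarConvex ℝ (c q) {z | (z, q) ∈ U}) (k : ℕ)
    (hg : ∀ μ, ContDiffOn ℝ ∞ (g μ) U) {p : Total n} (hp : p ∈ U) (α : Fin n) :
    dz α (homotopy c k g) p = ∫ s in Icc (0 : ℝ) 1, (s ^ k * g α (contraction c (p, s)) +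
        ∑ μ, s ^ (k + 1) * dz α (g μ) (contraction c (p, s)) * (p.1 μ - c p.2 μ)) := by
  have hW := isOpen_contractionDomain hU hc
  have hI := contDiffOn_homotopyIntegrand hc k hg
  have hmem : ∀ s ∈ Icc (0 : ℝ) 1, (p, s) ∈ contractionDomain U c := fun s h =>
    prod_subset_contractionDomain hs ⟨hp, h⟩
  have h := hasFDerivAt_integral_of_contDiffOn (μ := volume) hW isCompact_Icc
    (hI.of_le (by norm_cast)) hmem
  have h' : HasFDerivAt (homotopy c k g) _ p := h
  rw [dz, h'.fderiv, ContinuousLinearMap.integral_apply]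
  · refine setIntegral_congr_fun measurableSet_Icc fun s h => ?_
    exact fderiv_homotopyIntegrand hU hc k hg (hmem s h) α
  · refine ContinuousOn.integrableOn_compact isCompact_Icc ?_
    refine ContinuousOn.clm_comp ?_ continuousOn_const
    exact (hI.continuousOn_fderiv_of_isOpen hW (by simp)).comp (by fun_prop) hmem

/-- The fundamental theorem of calculus along the contraction. -/
theorem integral_contraction (hU : IsOpen U)
    (hs : ∀ q ∈ Prod.snd '' U, StarConvex ℝ (c q) {z | (z, q) ∈ U}) (k : ℕ)
    (hf : ContDiffOn ℝ ∞ f U) {p : Total n} (hp : p ∈ U) :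
    ∫ s in Icc (0 : ℝ) 1, ((k + 1) * s ^ k * f (contraction c (p, s)) +
      ∑ μ, s ^ (k + 1) * dz μ f (contraction c (p, s)) * (p.1 μ - c p.2 μ)) = f p := by
  have hd : ∀ s ∈ uIcc (0 : ℝ) 1, HasDerivAt (fun s => s ^ (k + 1) * f (contraction c (p, s)))
      ((k + 1) * s ^ k * f (contraction c (p, s)) +
      ∑ μ, s ^ (k + 1) * dz μ f (contraction c (p, s)) * (p.1 μ - c p.2 μ)) s := by
    intro s h
    rw [uIcc_of_le zero_le_one] at h
    have h1 := (hf.hasFDerivAt_fderiv_of_isOpen hU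
      (prod_subset_contractionDomain hs ⟨hp, h⟩).2).comp_hasDerivAt s (hasDerivAt_contraction p s)
    rw [fderiv_total_apply] at h1
    refine ((hasDerivAt_pow (k + 1) s).mul h1).congr_deriv ?_
    simp only [Nat.cast_add, Nat.cast_one, add_tsub_cancel_right, Function.comp_apply, zero_mul,
      add_zero, Finset.mul_sum, Pi.sub_apply]
    congr 1
    refine Finset.sum_congr rfl fun μ _ => ?_
    ring
  have hcont : ContinuousOn (fun s => (k + 1) * s ^ k * f (contraction c (p, s)) +
      ∑ μ, s ^ (k + 1) * dz μ f (contraction c (p, s)) * (p.1 μ - c p.2 μ)) (Icc 0 1) := by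
    refine ContinuousOn.add (ContinuousOn.mul (by fun_prop)
      (continuousOn_comp_contraction hs hf.continuousOn hp)) ?_
    refine continuousOn_finsetSum _ fun μ _ => ContinuousOn.mul (ContinuousOn.mul (by fun_prop)
      (continuousOn_comp_contraction hs (contDiffOn_dz hU hf μ).continuousOn hp)) continuousOn_const
  rw [integral_Icc_eq_integral_Ioc, ← intervalIntegral.integral_of_le zero_le_one,
    intervalIntegral.integral_eq_sub_of_hasDerivAt hd
      (ContinuousOn.intervalIntegrable (by rwa [uIcc_of_le zero_le_one]))]
  simp

/-- Poincaré's lemma for one-forms in `z`, with parameters `(x, t)`. -/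
theorem dz_homotopy_of_closed_one_form (hU : IsOpen U) (hc : ContDiffOn ℝ ∞ c (Prod.snd '' U))
    (hs : ∀ q ∈ Prod.snd '' U, StarConvex ℝ (c q) {z | (z, q) ∈ U})
    (hg : ∀ μ, ContDiffOn ℝ ∞ (g μ) U)
    (hcl : ∀ p ∈ U, ∀ μ ν, dz μ (g ν) p = dz ν (g μ) p) {p : Total n} (hp : p ∈ U) (α : Fin n) :
    dz α (homotopy c 0 g) p = g α p := by
  rw [dz_homotopy hU hc hs 0 hg hp, ← integral_contraction hU hs 0 (hg α) hp]
  refine setIntegral_congr_fun measurableSet_Icc fun s h => ?_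
  have hm := (prod_subset_contractionDomain hs (show (p, s) ∈ U ×ˢ Icc (0 : ℝ) 1 from ⟨hp, h⟩)).2
  -- Closedness exchanges `dz α (g μ)` for `dz μ (g α)`, which makes the integrand the derivative of
  -- `s * g α` along the contraction.
  simp [hcl _ hm α]

/-- Poincaré's lemma for two-forms in `z`, with parameters `(x, t)`. -/
theorem curl_homotopy_of_closed_two_form (hU : IsOpen U)
    (hc : ContDiffOn ℝ ∞ c (Prod.snd '' U))
    (hs : ∀ q ∈ Prod.snd '' U, StarConvex ℝ (c q) {z | (z, q) ∈ U})
    {N : Total n → Fin n → Fin n → ℝ} (hN : ContDiffOn ℝ ∞ N U)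
    (hskew : ∀ p ∈ U, ∀ μ ν, N p μ ν + N p ν μ = 0)
    (hcl : ∀ p ∈ U, ∀ μ ν l, dz l (fun r => N r μ ν) p - dz ν (fun r => N r μ l) p +
      dz μ (fun r => N r ν l) p = 0) {p : Total n} (hp : p ∈ U) (α β : Fin n) :
    N p α β = dz α (homotopy c 1 (fun μ r => N r μ β)) p -
      dz β (homotopy c 1 (fun μ r => N r μ α)) p := by
  have hN' := fun i j => contDiffOn_pi.1 (contDiffOn_pi.1 hN i) j
  have hint : ∀ i j, IntegrableOn (fun s : ℝ => s ^ 1 * N (contraction c (p, s)) i j +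
      ∑ μ, s ^ (1 + 1) * dz i (fun r => N r μ j) (contraction c (p, s)) * (p.1 μ - c p.2 μ))
      (Icc 0 1) := fun i j => by
    refine ContinuousOn.integrableOn_compact isCompact_Icc ?_
    refine ContinuousOn.add (ContinuousOn.mul (by fun_prop)
      (continuousOn_comp_contraction (f := fun r => N r i j) hs (hN' i j).continuousOn hp)) ?_
    refine continuousOn_finsetSum _ fun μ _ => ContinuousOn.mul (ContinuousOn.mul (by fun_prop)
      (continuousOn_comp_contraction hs (contDiffOn_dz hU (hN' μ j) i).continuousOn hp))
      continuousOn_const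
  rw [dz_homotopy hU hc hs 1 (fun μ => hN' μ β) hp, dz_homotopy hU hc hs 1 (fun μ => hN' μ α) hp,
    ← integral_sub (hint α β) (hint β α), ← integral_contraction hU hs 1 (hN' α β) hp]
  refine setIntegral_congr_fun measurableSet_Icc fun s h => ?_
  have hm := (prod_subset_contractionDomain hs (show (p, s) ∈ U ×ˢ Icc (0 : ℝ) 1 from ⟨hp, h⟩)).2
  have hds : ∀ μ, dz μ (fun r => N r β α) (contraction c (p, s)) =
      -dz μ (fun r => N r α β) (contraction c (p, s)) := fun μ => by
    unfold dz
    rw [fderiv_congr_of_eqOn hU (g := fun r => -N r α β)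
      (fun r hr => by linarith [hskew r hr α β]) hm, fderiv_fun_neg, neg_apply]
  have hb : N (contraction c (p, s)) β α = -N (contraction c (p, s)) α β := by
    linarith [hskew _ hm α β]
  -- By closedness and skewness the difference of the two integrands keeps only the derivatives of
  -- `N_{αβ}`, while `N_{αβ} - N_{βα}` doubles. The factor `2` matches the derivative of `s ^ 2`,
  -- which is why the weight is `k = 1` for two-forms.
  have hterm : ∀ μ, dz α (fun r => N r μ β) (contraction c (p, s)) =
      dz β (fun r => N r μ α) (contraction c (p, s)) +
        dz μ (fun r => N r α β) (contraction c (p, s)) := fun μ => by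
    linarith [hcl _ hm μ β α, hds μ]
  simp only [hb, hterm, mul_add, add_mul, Finset.sum_add_distrib]
  push_cast
  ring

end Homotopy

/-! ### Closed systems are Birkhoffian, globally on star-shaped regions and locally in general -/

section Existence

variable {n : ℕ} {U V : Set (Total n)} {M K : Total n → Fin n → Fin n → ℝ}
  {D : Total n → Fin n → ℝ}

theorem IsClosedSystem.isBirkhoffianOn (hU : IsOpen U) (hM : ContDiffOn ℝ ∞ M U)
    (hK : ContDiffOn ℝ ∞ K U) (hD : ContDiffOn ℝ ∞ D U) (hstar : IsStarShapedInZ U)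
    (h : IsClosedSystem U M K D) : IsBirkhoffianOn U M K D := by
  obtain ⟨c, hc, hs⟩ := hstar
  have hM' := fun i j => contDiffOn_pi.1 (contDiffOn_pi.1 hM i) j
  have hK' := fun i j => contDiffOn_pi.1 (contDiffOn_pi.1 hK i) j
  let F : Total n → Fin n → ℝ := fun p ν => homotopy c 1 (fun μ r => M r μ ν) p
  let G : Total n → Fin n → ℝ := fun p ν => homotopy c 1 (fun μ r => K r μ ν) p
  have hF : ∀ ν, ContDiffOn ℝ ∞ (fun r => F r ν) U := fun ν =>
    contDiffOn_homotopy hU hc hs 1 (fun μ => hM' μ ν)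
  have hG : ∀ ν, ContDiffOn ℝ ∞ (fun r => G r ν) U := fun ν =>
    contDiffOn_homotopy hU hc hs 1 (fun μ => hK' μ ν)
  have hMF : ∀ p ∈ U, ∀ μ ν, M p μ ν = dz μ (fun r => F r ν) p - dz ν (fun r => F r μ) p :=
    fun p hp μ ν => curl_homotopy_of_closed_two_form hU hc hs hM h.skewM h.closedM hp μ ν
  have hKG : ∀ p ∈ U, ∀ μ ν, K p μ ν = dz μ (fun r => G r ν) p - dz ν (fun r => G r μ) p :=
    fun p hp μ ν => curl_homotopy_of_closed_two_form hU hc hs hK h.skewK h.closedK hp μ ν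
  -- The Birkhoffian has to satisfy `dz μ B = A μ`. The compatibility condition, with mixed
  -- derivatives exchanged, says that `A` is a closed one-form.
  let A : Fin n → Total n → ℝ := fun μ p =>
    -(D p μ + dt (fun r => F r μ) p + dx (fun r => G r μ) p)
  have hDs := contDiffOn_pi.1 hD
  have hA : ∀ μ, ContDiffOn ℝ ∞ (A μ) U := fun μ =>
    (((hDs μ).add (contDiffOn_dt hU (hF μ))).add (contDiffOn_dx hU (hG μ))).neg
  have hAd : ∀ p ∈ U, ∀ i j, dz i (A j) p = -(dz i (fun r => D r j) p +
      dz i (dt (fun r => F r j)) p + dz i (dx (fun r => G r j)) p) := fun p hp i j => by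
    unfold dz
    rw [fderiv_fun_neg, neg_apply, fderiv_add_apply_of_contDiffOn hU
      ((hDs j).add (contDiffOn_dt hU (hF j))) (contDiffOn_dx hU (hG j)) hp,
      fderiv_add_apply_of_contDiffOn hU (hDs j) (contDiffOn_dt hU (hF j)) hp]
  have hAcl : ∀ p ∈ U, ∀ μ ν, dz μ (A ν) p = dz ν (A μ) p := fun p hp μ ν => by
    have e1 : dt (fun r => M r μ ν) p = dt (dz μ (fun r => F r ν)) p -
      dt (dz ν (fun r => F r μ)) p := fderiv_curl hU (contDiffOn_pi.2 hF) hMF hp μ ν _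
    have e2 : dx (fun r => K r μ ν) p = dx (dz μ (fun r => G r ν)) p -
      dx (dz ν (fun r => G r μ)) p := fderiv_curl hU (contDiffOn_pi.2 hG) hKG hp μ ν _
    have cF : ∀ i j, dt (dz i (fun r => F r j)) p = dz i (dt (fun r => F r j)) p :=
      fun i j => fderiv_fderiv_comm hU (hF j) hp _ _
    have cG : ∀ i j, dx (dz i (fun r => G r j)) p = dz i (dx (fun r => G r j)) p :=
      fun i j => fderiv_fderiv_comm hU (hG j) hp _ _
    rw [cF, cF] at e1
    rw [cG, cG] at e2
    rw [hAd p hp, hAd p hp]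
    linarith [h.compat p hp μ ν]
  refine ⟨F, G, homotopy c 0 A, ⟨contDiffOn_pi.2 hF, contDiffOn_pi.2 hG,
    contDiffOn_homotopy hU hc hs 0 hA⟩, hMF, hKG, fun p hp μ => ?_⟩
  rw [dz_homotopy_of_closed_one_form hU hc hs hA hAcl hp]
  simp only [A]
  ring

/-- In the sup metric a ball is a product of balls, so each nonempty slice is the same ball about
`p.1` and a constant centre works. -/
theorem isStarShapedInZ_ball (p : Total n) (r : ℝ) : IsStarShapedInZ (Metric.ball p r) := by
  refine ⟨fun _ => p.1, contDiffOn_const, ?_⟩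
  rintro q ⟨⟨z, q'⟩, hz, rfl⟩ y hy a b ha hb hab
  have hb' : Metric.ball p r = Metric.ball p.1 r ×ˢ Metric.ball p.2 r :=
    (ball_prod_same p.1 p.2 r).symm
  have hy' : (y, q') ∈ Metric.ball p r := hy
  change (a • p.1 + b • y, q') ∈ Metric.ball p r
  rw [hb'] at hy' ⊢
  have hr : 0 < r := dist_nonneg.trans_lt hy'.1
  exact ⟨convex_ball p.1 r (Metric.mem_ball_self hr) hy'.1 ha hb hab, hy'.2⟩

theorem IsClosedSystem.mono (h : IsClosedSystem U M K D) (hV : V ⊆ U) :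
    IsClosedSystem V M K D :=
  ⟨fun p hp => h.skewM p (hV hp), fun p hp => h.skewK p (hV hp), fun p hp => h.closedM p (hV hp),
    fun p hp => h.closedK p (hV hp), fun p hp => h.compat p (hV hp)⟩

theorem isClosedSystem_iff_locally_isBirkhoffianOn (hU : IsOpen U) (hM : ContDiffOn ℝ ∞ M U)
    (hK : ContDiffOn ℝ ∞ K U) (hD : ContDiffOn ℝ ∞ D U) : IsClosedSystem U M K D ↔
      ∀ p ∈ U, ∃ V : Set (Total n), IsOpen V ∧ p ∈ V ∧ V ⊆ U ∧ IsBirkhoffianOn V M K D := by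
  constructor
  · intro h p hp
    obtain ⟨r, hr, hrU⟩ := Metric.isOpen_iff.1 hU p hp
    exact ⟨Metric.ball p r, Metric.isOpen_ball, Metric.mem_ball_self hr, hrU,
      (h.mono hrU).isBirkhoffianOn Metric.isOpen_ball (hM.mono hrU) (hK.mono hrU) (hD.mono hrU)
        (isStarShapedInZ_ball p r)⟩
  · intro h
    have hloc : ∀ p ∈ U, ∃ V : Set (Total n), p ∈ V ∧ IsClosedSystem V M K D := fun p hp => by
      obtain ⟨V, hV, hpV, -, F, G, B, hd, hr⟩ := h p hp
      exact ⟨V, hpV, hr.isClosedSystem hV hd⟩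
    choose! V hpV hV using hloc
    exact ⟨fun p hp => (hV p hp).skewM p (hpV p hp), fun p hp => (hV p hp).skewK p (hpV p hp),
      fun p hp => (hV p hp).closedM p (hpV p hp), fun p hp => (hV p hp).closedK p (hpV p hp),
      fun p hp => (hV p hp).compat p (hpV p hp)⟩

end Existence

/-! ### The Pfaffian action and its variational derivative -/

section Action

variable {n : ℕ} {U : Set (Total n)} {Ω : Set Base} {z η : Base → Fin n → ℝ}
  {M K : Total n → Fin n → Fin n → ℝ} {D : Total n → Fin n → ℝ}
  {F G : Total n → Fin n → ℝ} {B : Total n → ℝ} {x₁ x₂ t₁ t₂ : ℝ}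

/-- The exterior derivative in `z` of the one-form `F`. -/
def curl (F : Total n → Fin n → ℝ) (p : Total n) (μ ν : Fin n) : ℝ :=
  dz μ (fun r => F r ν) p - dz ν (fun r => F r μ) p

/-- The zeroth-order term of the Birkhoff system of `F`, `G`, `B`. -/
def birkhoffForce (F G : Total n → Fin n → ℝ) (B : Total n → ℝ) (p : Total n) (μ : Fin n) : ℝ :=
  -(dz μ B p + dt (fun r => F r μ) p + dx (fun r => G r μ) p)

theorem contDiffOn_curl (hU : IsOpen U) (hF : ContDiffOn ℝ ∞ F U) :
    ContDiffOn ℝ ∞ (curl F) U :=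
  contDiffOn_pi.2 fun μ => contDiffOn_pi.2 fun ν =>
    (contDiffOn_dz hU (contDiffOn_pi.1 hF ν) μ).sub (contDiffOn_dz hU (contDiffOn_pi.1 hF μ) ν)

theorem contDiffOn_birkhoffForce (hU : IsOpen U) (hd : IsSmoothData U F G B) :
    ContDiffOn ℝ ∞ (birkhoffForce F G B) U :=
  contDiffOn_pi.2 fun μ => (((contDiffOn_dz hU hd.smoothB μ).add
    (contDiffOn_dt hU (contDiffOn_pi.1 hd.smoothF μ))).add
    (contDiffOn_dx hU (contDiffOn_pi.1 hd.smoothG μ))).neg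

/-- The density `F_ν η^ν` along the field `z`. -/
def contract (F : Total n → Fin n → ℝ) (z η : Base → Fin n → ℝ) (q : Base) : ℝ :=
  ∑ ν, F (z q, q) ν * η q ν

theorem contDiffOn_contract (hz : IsFieldOn U Ω z) (hF : ContDiffOn ℝ ∞ F U)
    (hη : ContDiff ℝ ∞ η) : ContDiffOn ℝ ∞ (contract F z η) Ω :=
  ContDiffOn.sum fun ν _ => (hz.contDiffOn_comp (contDiffOn_pi.1 hF ν)).mul
    (contDiff_pi.1 hη ν).contDiffOn

theorem fderiv_contract (hU : IsOpen U) (hz : IsFieldOn U Ω z) (hF : ContDiffOn ℝ ∞ F U)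
    (hη : ContDiff ℝ ∞ η) {q : Base} (hq : q ∈ Ω) (v : Base) :
    fderiv ℝ (contract F z η) q v = ∑ ν, (fderiv ℝ (fun q => F (z q, q) ν) q v * η q ν +
      F (z q, q) ν * fderiv ℝ η q v ν) := by
  have hηd : DifferentiableAt ℝ η q := hη.differentiable (by simp) q
  have h : HasFDerivAt (contract F z η) _ q := HasFDerivAt.fun_sum (u := Finset.univ) fun ν _ =>
    (hz.hasFDerivAt_comp hU (contDiffOn_pi.1 hF ν) hq).differentiableAt.hasFDerivAt.fun_mul
      (differentiableAt_pi.1 hηd ν).hasFDerivAt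
  rw [h.fderiv]
  simp only [sum_apply, add_apply, smul_apply, smul_eq_mul, fderiv_coord hηd]
  refine Finset.sum_congr rfl fun ν _ => ?_
  ring

/-- The first variation of the Lagrange density is the Birkhoff system paired with the variation,
up to a divergence. -/
theorem densityVariation_eq (hU : IsOpen U) (hd : IsSmoothData U F G B) (hz : IsFieldOn U Ω z)
    (hη : ContDiff ℝ ∞ η) {q : Base} (hq : q ∈ Ω) :
    densityVariation F G B z η q =
      ∑ μ, sysExpr (curl F) (curl G) (birkhoffForce F G B) z q μ * η q μ +
        (fderiv ℝ (contract G z η) q (1, 0) + fderiv ℝ (contract F z η) q (0, 1)) := by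
  have hF := contDiffOn_pi.1 hd.smoothF
  have hG := contDiffOn_pi.1 hd.smoothG
  rw [fderiv_contract hU hz hd.smoothF hη hq, fderiv_contract hU hz hd.smoothG hη hq,
    densityVariation]
  simp only [← Finset.sum_add_distrib]
  refine Finset.sum_congr rfl fun μ _ => ?_
  rw [hz.fderiv_comp_t hU (hF μ) hq, hz.fderiv_comp_x hU (hG μ) hq, sysExpr, birkhoffForce]
  simp only [curl, sub_mul, Finset.sum_sub_distrib, mul_comm (fieldT z q _),
    mul_comm (fieldX z q _), Finset.sum_add_distrib]
  simp only [fieldT, fieldX]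
  ring

theorem pfaffianAction_eq (hd : IsSmoothData U F G B) (hx : x₁ ≤ x₂) (ht : t₁ ≤ t₂)
    (hz : IsFieldOn U Ω z) (hR : Icc x₁ x₂ ×ˢ Icc t₁ t₂ ⊆ Ω) (hη : ContDiff ℝ ∞ η) {s : ℝ}
    (hs : ∀ q ∈ Icc x₁ x₂ ×ˢ Icc t₁ t₂, (z q + s • η q, q) ∈ U) :
    pfaffianAction F G B x₁ x₂ t₁ t₂ (z + s • η) =
      ∫ q in Icc x₁ x₂ ×ˢ Icc t₁ t₂, lagrangeDensity F G B (z + s • η) q := by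
  refine integral_integral_eq_setIntegral_Icc hx ht ?_
  exact (contDiffOn_lagrangeDensity_add_smul hd hz hη).continuousOn.comp
    (f := fun q => (s, q)) (by fun_prop) fun q hq => ⟨hR hq, hs q hq⟩

/-- The first variation of the Pfaffian action. -/
theorem hasDerivAt_pfaffianAction (hU : IsOpen U) (hd : IsSmoothData U F G B) (hx : x₁ ≤ x₂)
    (ht : t₁ ≤ t₂) (hz : IsFieldOn U Ω z) (hR : Icc x₁ x₂ ×ˢ Icc t₁ t₂ ⊆ Ω)
    (hη : ContDiff ℝ ∞ η) (hη0 : ∀ q ∈ frontier (Icc x₁ x₂ ×ˢ Icc t₁ t₂), η q = 0) :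
    HasDerivAt (fun s : ℝ => pfaffianAction F G B x₁ x₂ t₁ t₂ (z + s • η))
      (∫ q in Icc x₁ x₂ ×ˢ Icc t₁ t₂,
        ∑ μ, sysExpr (curl F) (curl G) (birkhoffForce F G B) z q μ * η q μ) 0 := by
  set R : Set Base := Icc x₁ x₂ ×ˢ Icc t₁ t₂ with hRdef
  have hRc : IsCompact R := isCompact_Icc.prod isCompact_Icc
  have hW := isOpen_variationDomain hU hz hη
  have hΦ := contDiffOn_lagrangeDensity_add_smul hd hz hη
  set W : Set (ℝ × Base) := {w | w.2 ∈ Ω ∧ (z w.2 + w.1 • η w.2, w.2) ∈ U} with hWdef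
  have h0 : ∀ q ∈ Ω, ((0 : ℝ), q) ∈ W := fun q hq => ⟨hq, by simpa using hz.graph q hq⟩
  -- By compactness of `R`, for all `s` near `0` the varied field stays in `U` over the whole
  -- rectangle. Only there is the iterated integral identified with the set integral, and the
  -- derivative at `0` needs no more.
  obtain ⟨u, v, hu, -, h0u, hRv, huv⟩ := generalized_tube_lemma (isCompact_singleton (x := (0 : ℝ)))
    hRc hW (by rintro ⟨s, q⟩ ⟨rfl, hq⟩; exact h0 q (hR hq))
  have hev : (fun s : ℝ => pfaffianAction F G B x₁ x₂ t₁ t₂ (z + s • η)) =ᶠ[𝓝 0]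
      fun s => ∫ q in R, lagrangeDensity F G B (z + s • η) q := by
    filter_upwards [hu.mem_nhds (h0u rfl)] with s hs
    exact pfaffianAction_eq hd hx ht hz hR hη fun q hq =>
      (huv (show (s, q) ∈ u ×ˢ v from ⟨hs, hRv hq⟩)).2
  have hmain := (hasFDerivAt_integral_of_contDiffOn (μ := volume) hW hRc (hΦ.of_le (by norm_cast))
    (fun q hq => h0 q (hR hq))).hasDerivAt
  refine (hmain.congr_of_eventuallyEq hev).congr_deriv ?_
  have hcF := contDiffOn_contract hz hd.smoothF hη
  have hcG := contDiffOn_contract hz hd.smoothG hη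
  have hcd : ∀ {k : Base → ℝ} (v : Base), ContDiffOn ℝ ∞ k Ω →
      ContinuousOn (fun q => fderiv ℝ k q v) R := fun v hk =>
    ((hk.continuousOn_fderiv_of_isOpen hz.isOpen (by simp)).clm_apply continuousOn_const).mono hR
  have hsys : ContinuousOn (fun q =>
      ∑ μ, sysExpr (curl F) (curl G) (birkhoffForce F G B) z q μ * η q μ) R :=
    continuousOn_finsetSum _ fun μ _ => ((hz.contDiffOn_sysExpr (contDiffOn_curl hU hd.smoothF)
      (contDiffOn_curl hU hd.smoothG) (contDiffOn_birkhoffForce hU hd) μ).continuousOn.mono hR).mul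
      (contDiff_pi.1 hη μ).continuous.continuousOn
  rw [ContinuousLinearMap.integral_apply]
  · have hpt : ∀ q ∈ R, ((fderiv ℝ (fun w : ℝ × Base => lagrangeDensity F G B (z + w.1 • η) w.2)
        (0, q)).comp (ContinuousLinearMap.inl ℝ ℝ Base)) 1 =
        ∑ μ, sysExpr (curl F) (curl G) (birkhoffForce F G B) z q μ * η q μ +
          (fderiv ℝ (contract G z η) q (1, 0) + fderiv ℝ (contract F z η) q (0, 1)) := by
      intro q hq
      have h1 := ((hΦ.hasFDerivAt_fderiv_of_isOpen hW (h0 q (hR hq))).comp (0 : ℝ)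
        (hasFDerivAt_prodMk_left (0 : ℝ) q)).hasDerivAt
      rw [h1.unique (hasDerivAt_lagrangeDensity hU hd hz hη (hR hq)),
        densityVariation_eq hU hd hz hη (hR hq)]
    have hdiv : IntegrableOn (fun q => fderiv ℝ (contract G z η) q (1, 0) +
        fderiv ℝ (contract F z η) q (0, 1)) R :=
      ((hcd _ hcG).add (hcd _ hcF)).integrableOn_compact hRc
    rw [setIntegral_congr_fun hRc.measurableSet hpt,
      integral_add (hsys.integrableOn_compact hRc) hdiv,
      integral_divergence_eq_zero hx ht hz.isOpen hR hcG hcF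
        (fun q hq => by simp [contract, hη0 q hq]) (fun q hq => by simp [contract, hη0 q hq]),
      add_zero]
  · refine ContinuousOn.integrableOn_compact hRc ?_
    refine ContinuousOn.clm_comp ?_ continuousOn_const
    exact (hΦ.continuousOn_fderiv_of_isOpen hW (by simp)).comp (by fun_prop)
      fun q hq => h0 q (hR hq)

theorem integral_sysExpr_eq (hM : ContDiffOn ℝ ∞ M U) (hK : ContDiffOn ℝ ∞ K U)
    (hD : ContDiffOn ℝ ∞ D U) (hx : x₁ ≤ x₂) (ht : t₁ ≤ t₂) (hz : IsFieldOn U Ω z)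
    (hR : Icc x₁ x₂ ×ˢ Icc t₁ t₂ ⊆ Ω) (hη : ContDiff ℝ ∞ η) :
    ∫ t in t₁..t₂, ∫ x in x₁..x₂, ∑ μ, sysExpr M K D z (x, t) μ * η (x, t) μ =
      ∫ q in Icc x₁ x₂ ×ˢ Icc t₁ t₂, ∑ μ, sysExpr M K D z q μ * η q μ :=
  integral_integral_eq_setIntegral_Icc (f := fun q => ∑ μ, sysExpr M K D z q μ * η q μ) hx ht <|
    continuousOn_finsetSum _ fun μ _ =>
      ((hz.contDiffOn_sysExpr hM hK hD μ).continuousOn.mono hR).mul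
        (contDiff_pi.1 hη μ).continuous.continuousOn

theorem IsBirkhoffRepr.isDerivedFromAction (hU : IsOpen U) (hM : ContDiffOn ℝ ∞ M U)
    (hK : ContDiffOn ℝ ∞ K U) (hD : ContDiffOn ℝ ∞ D U) (hd : IsSmoothData U F G B)
    (h : IsBirkhoffRepr U M K D F G B) : IsDerivedFromAction U M K D F G B := by
  intro x₁ x₂ t₁ t₂ hx ht Ω z hz hR η hη hη0
  rw [integral_sysExpr_eq hM hK hD hx.le ht.le hz hR hη]
  convert hasDerivAt_pfaffianAction hU hd hx.le ht.le hz hR hη hη0 using 1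
  refine setIntegral_congr_fun (measurableSet_Icc.prod measurableSet_Icc) fun q hq => ?_
  have hp := hz.graph q (hR hq)
  simp only [sysExpr, curl, birkhoffForce, h.eqM _ hp, h.eqK _ hp, h.eqD _ hp]

/-- The system derived from an action agrees with the Birkhoff system along every field. -/
theorem IsDerivedFromAction.sysExpr_eq (hU : IsOpen U) (hM : ContDiffOn ℝ ∞ M U)
    (hK : ContDiffOn ℝ ∞ K U) (hD : ContDiffOn ℝ ∞ D U) (hd : IsSmoothData U F G B)
    (h : IsDerivedFromAction U M K D F G B) (hz : IsFieldOn U Ω z) {q : Base} (hq : q ∈ Ω)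
    (μ : Fin n) :
    sysExpr M K D z q μ - sysExpr (curl F) (curl G) (birkhoffForce F G B) z q μ = 0 := by
  -- In the sup metric a closed ball is a square, hence an admissible rectangle for the action.
  obtain ⟨r, hr, hrΩ⟩ := Metric.nhds_basis_closedBall.mem_iff.1 (hz.isOpen.mem_nhds hq)
  have hball : Metric.closedBall q r =
      Icc (q.1 - r) (q.1 + r) ×ˢ Icc (q.2 - r) (q.2 + r) := by
    rw [← Real.closedBall_eq_Icc, ← Real.closedBall_eq_Icc]
    exact (closedBall_prod_same q.1 q.2 r).symm
  set R : Set Base := Icc (q.1 - r) (q.1 + r) ×ˢ Icc (q.2 - r) (q.2 + r) with hRdef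
  rw [hball] at hrΩ
  have hbR : Metric.ball q r ⊆ R := hball ▸ Metric.ball_subset_closedBall
  have hRc : IsCompact R := isCompact_Icc.prod isCompact_Icc
  have h1 := hz.contDiffOn_sysExpr hM hK hD μ
  have h2 := hz.contDiffOn_sysExpr (contDiffOn_curl hU hd.smoothF)
    (contDiffOn_curl hU hd.smoothG) (contDiffOn_birkhoffForce hU hd) μ
  refine eqOn_zero_of_integral_mul_eq_zero (μ := volume) (Metric.isOpen_ball (x := q) (ε := r))
    ((h1.sub h2).continuousOn.mono (hbR.trans hrΩ)) (fun g hg hc hs => ?_) q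
    (Metric.mem_ball_self hr)
  have hη := isTestOn_single hg hc hs μ
  have hxr : q.1 - r < q.1 + r := by linarith
  have htr : q.2 - r < q.2 + r := by linarith
  -- The open ball lies in the interior of `R`, so a function supported in it vanishes on the
  -- frontier.
  have hη0 : ∀ q' ∈ frontier R, (Pi.single μ (g q') : Fin n → ℝ) = 0 := fun q' hq' => by
    have : q' ∉ tsupport g := fun hmem =>
      hq'.2 (interior_maximal hbR Metric.isOpen_ball (hs hmem))
    simp [image_eq_zero_of_notMem_tsupport this]
  have e1 := h _ _ _ _ hxr htr Ω z hz hrΩ _ hη.smooth hη0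
  rw [integral_sysExpr_eq hM hK hD hxr.le htr.le hz hrΩ hη.smooth] at e1
  -- The same action has the derivative assumed by hypothesis and the one computed from `F, G, B`;
  -- uniqueness equates the two integrals.
  have e2 := e1.unique (hasDerivAt_pfaffianAction hU hd hxr.le htr.le hz hrΩ hη.smooth hη0)
  simp only [Pi.single_apply, mul_ite, mul_zero, Finset.sum_ite_eq', Finset.mem_univ,
    if_true] at e2
  have hi : ∀ {f : Base → ℝ}, ContDiffOn ℝ ∞ f Ω → IntegrableOn (fun q => f q * g q) R :=
    fun hf => ((hf.continuousOn.mono hrΩ).mul hg.continuous.continuousOn).integrableOn_compact hRc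
  rw [← sub_eq_zero, ← integral_sub (hi h1) (hi h2)] at e2
  rw [← setIntegral_eq_integral_of_forall_compl_eq_zero (s := R), ← e2]
  · refine integral_congr_ae (Eventually.of_forall fun q' => ?_)
    ring
  · intro q' hq'
    have : q' ∉ tsupport g := fun hmem => hq' (hbR (hs hmem))
    simp [image_eq_zero_of_notMem_tsupport this]

theorem IsDerivedFromAction.isBirkhoffRepr (hU : IsOpen U) (hM : ContDiffOn ℝ ∞ M U)
    (hK : ContDiffOn ℝ ∞ K U) (hD : ContDiffOn ℝ ∞ D U) (hd : IsSmoothData U F G B)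
    (h : IsDerivedFromAction U M K D F G B) : IsBirkhoffRepr U M K D F G B := by
  have key : ∀ p ∈ U, ∀ μ, (fun ν => M p μ ν - curl F p μ ν) = 0 ∧
      (fun ν => K p μ ν - curl G p μ ν) = 0 ∧ D p μ - birkhoffForce F G B p μ = 0 := by
    intro p hp μ
    refine coeff_eq_zero_of_affine fun a b => ?_
    have h1 := h.sysExpr_eq hU hM hK hD hd (isFieldOn_affineField p a b hU) (q := p.2)
      (by simpa using hp) μ
    simp only [sysExpr, affineField_self, fieldT_affineField, fieldX_affineField] at h1
    simp only [sub_mul, Finset.sum_sub_distrib]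
    linarith
  exact ⟨fun p hp μ ν => sub_eq_zero.1 (congrFun (key p hp μ).1 ν),
    fun p hp μ ν => sub_eq_zero.1 (congrFun (key p hp μ).2.1 ν),
    fun p hp μ => sub_eq_zero.1 (key p hp μ).2.2⟩

end Action

end Birkhoff

end

theorem proposition2p2 {n : ℕ} (U : Set (Birkhoff.Total n)) (hU : IsOpen U)
    (M K : Birkhoff.Total n → Fin n → Fin n → ℝ) (D : Birkhoff.Total n → Fin n → ℝ)
    (hM : ContDiffOn ℝ ∞ M U) (hK : ContDiffOn ℝ ∞ K U) (hD : ContDiffOn ℝ ∞ D U) :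
    -- on a region star-shaped in `z`
    (Birkhoff.IsStarShapedInZ U →
      (Birkhoff.IsSelfAdjointOn U M K D ↔ Birkhoff.IsBirkhoffianOn U M K D) ∧
      (Birkhoff.IsSelfAdjointOn U M K D ↔ Birkhoff.IsPfaffianDerivableOn U M K D)) ∧
    -- on an arbitrary region, locally
    (Birkhoff.IsSelfAdjointOn U M K D ↔
      ∀ p ∈ U, ∃ V : Set (Birkhoff.Total n), IsOpen V ∧ p ∈ V ∧ V ⊆ U ∧
        Birkhoff.IsBirkhoffianOn V M K D) ∧
    -- Birkhoff's equations of `F`, `G`, `B` are those of the Pfaffian action of `F`, `G`, `B`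
    (∀ (F G : Birkhoff.Total n → Fin n → ℝ) (B : Birkhoff.Total n → ℝ),
      Birkhoff.IsSmoothData U F G B →
      (Birkhoff.IsBirkhoffRepr U M K D F G B ↔
        Birkhoff.IsDerivedFromAction U M K D F G B)) := by
  have hrepr : ∀ (F G : Birkhoff.Total n → Fin n → ℝ) (B : Birkhoff.Total n → ℝ),
      Birkhoff.IsSmoothData U F G B → (Birkhoff.IsBirkhoffRepr U M K D F G B ↔
        Birkhoff.IsDerivedFromAction U M K D F G B) := fun F G B hd =>
    ⟨fun h => h.isDerivedFromAction hU hM hK hD hd, fun h => h.isBirkhoffRepr hU hM hK hD hd⟩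
  have hsa := Birkhoff.isSelfAdjointOn_iff_isClosedSystem hU hM hK hD
  refine ⟨fun hstar => ?_, hsa.trans
    (Birkhoff.isClosedSystem_iff_locally_isBirkhoffianOn hU hM hK hD), hrepr⟩
  have hbirk : Birkhoff.IsSelfAdjointOn U M K D ↔ Birkhoff.IsBirkhoffianOn U M K D := by
    rw [hsa]
    refine ⟨fun h => h.isBirkhoffianOn hU hM hK hD hstar, ?_⟩
    rintro ⟨F, G, B, hd, hr⟩
    exact hr.isClosedSystem hU hd
  refine ⟨hbirk, hbirk.trans ?_⟩
  -- The same triple `(F, G, B)` serves on both sides, so the equivalence holds under the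
  -- existential quantifiers.
  exact exists_congr fun F => exists_congr fun G => exists_congr fun B =>
    and_congr_right fun hd => hrepr F G B hd
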